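/- All vector spaces are over $\mathbb C$. For a vector space $U$, $U((x))$ denotes the lower truncated formal Laurent series with coefficients in $U$, and $U((x_1,x_2))$ the formal series in $x_1,x_2$ whose exponents are bounded below in both variables. For rational expressions, $\iota_{x_2,x_1}$ denotes expansion in nonnegative powers of $x_1$, i.e. in $\mathbb C((x_2))((x_1))$; $(x_1-x_2)^n$ is expanded in nonnegative powers of the second summand. For $f=p/q\in\mathbb C(x)$ put $f(e^x)=p(e^x)/q(e^x)\in\mathbb C((x))$. Let $\delta(x)=\sum_{n\in\mathbb Z}x^n$, and let $\mathrm{Res}_{x_0}$ be the coefficient of $x_0^{-1}$. A weak quantum vertex algebra is a vector space $V$ with a linear map $Y(\cdot,x):V\to\mathrm{Hom}(V,V((x)))$ and a vector $\mathbf 1\in V$ such that $Y(\mathbf 1,x)v=v$, $Y(v,x)\mathbf 1\in V[[x]]$ has constant term $v$, and for all $u,v\in V$ there are finitely many $u^{(i)},v^{(i)}\in V$, $f_i\in\mathbb C((x))$ with $$x_0^{-1}\delta\Big(\frac{x_1-x_2}{x_0}\Big)Y(u,x_1)Y(v,x_2)-x_0^{-1}\delta\Big(\frac{x_2-x_1}{-x_0}\Big)\sum_i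 f_i(x_2-x_1)Y(v^{(i)},x_2)Y(u^{(i)},x_1)=x_2^{-1}\delta\Big(\frac{x_1-x_0}{x_2}\Big)Y(Y(u,x_0)v,x_2).$$ For $u,v,u^{(i)},v^{(i)}\in V$ and $f_i\in\mathbb C(x)$ $(1\le i\le r)$ consider the relation $$(x_1-x_2)^kY(u,x_1)Y(v,x_2)=(x_1-x_2)^k\sum_{i=1}^r\iota_{x_2,x_1}\big(f_i(e^{x_1-x_2})\big)Y(v^{(i)},x_2)Y(u^{(i)},x_1).\qquad(*)$$ $V$ is of T-type if for all $u,v\in V$ there are such $u^{(i)},v^{(i)},f_i$ for which $(*)$ holds for some $k\in\mathbb N$. An automorphism of $V$ is a linear bijection $\sigma$ with $\sigma(\mathbf 1)=\mathbf 1$ and $\sigma(Y(u,x)v)=Y(\sigma u,x)\sigma v$. A $\phi$-coordinated quasi $V$-module is a vector space $W$ with a linear map $Y_W(\cdot,x):V\to\mathrm{Hom}(W,W((x)))$ such that $Y_W(\mathbf 1,x)=1_W$ and for all $u,v\in V$ there is a nonzero polynomial $p$ with $p(x_1/x_2)Y_W(u,x_1)Y_W(v,x_2)\in\mathrm{Hom}(W,W((x_1,x_2)))$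 and $$p(e^z)Y_W(Y(u,z)v,x_2)=\big(p(x_1/x_2)Y_W(u,x_1)Y_W(v,x_2)\big)\big|_{x_1=x_2e^z}.$$ If $G$ is a group acting on $V$ by automorphisms and $\chi:G\to\mathbb C^\times$ is a homomorphism, such a $W$ is called $G$-covariant if $Y_W(gv,x)=Y_W(v,\chi(g)x)$ for all $g\in G$, $v\in V$, and for all $u,v\in V$ there is a nonzero polynomial $p$ all of whose zeros lie in $\chi(G)$ with $p(x_1/x_2)Y_W(u,x_1)Y_W(v,x_2)\in\mathrm{Hom}(W,W((x_1,x_2)))$. **Theorem.** Let $V$ be a weak quantum vertex algebra of T-type, let $G$ be a group acting on $V$ by automorphisms, let $\chi:G\to\mathbb C^\times$ be a homomorphism, and let $(W,Y_W)$ be a $G$-covariant $\phi$-coordinated quasi $V$-module. Let $u,v,u^{(i)},v^{(i)}\in V$ and $f_i\in\mathbb C(x)$ $(1\le i\le r)$ be such that $(*)$ holds for some $k\in\mathbb N$. Then there are finitely many $g_1,\dots,g_n\in G$ $(n\ge 0)$ with $\chi(g_1),\dots,\chi(g_n)$ distinct such that $$Y_W(u,x_1)Y_W(v,x)-\sum_{i=1}^r\iota_{x,x_1}\big(f_i(x_1/x)\big)Y_W(v^{(i)},x)Y_W(u^{(i)},x_1)=\mathrm{Res}_{x_0}\sum_{j=1}^nY_W(Y(g_ju,x_0)v,x)\,e^{x_0\left(x\frac{\partial}{\partial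 x}\right)}\delta\Big(\frac{\chi(g_j)x}{x_1}\Big).$$ Furthermore, if $\chi$ is injective, then $\mathrm{Res}_{x_0}Y_W(Y(gu,x_0)v,x)\,e^{x_0\left(x\frac{\partial}{\partial x}\right)}\delta\big(\frac{\chi(g)x}{x_1}\big)$ is nonzero for only finitely many $g\in G$, and $$Y_W(u,x_1)Y_W(v,x)-\sum_{i=1}^r\iota_{x,x_1}\big(f_i(x_1/x)\big)Y_W(v^{(i)},x)Y_W(u^{(i)},x_1)=\sum_{g\in G}\mathrm{Res}_{x_0}Y_W(Y(gu,x_0)v,x)\,e^{x_0\left(x\frac{\partial}{\partial x}\right)}\delta\Big(\frac{\chi(g)x}{x_1}\Big).$$ -/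

import Mathlib

open scoped LaurentSeries PowerSeries

noncomputable section

/-!
# Formal calculus

A formal series in `x` is a function `ℤ → M`, in two variables a function `ℤ × ℤ → M`, in three
variables a function `ℤ × ℤ × ℤ → M`: it sends a tuple of exponents to the coefficient of the
monomial with these exponents. The order of the variables is fixed throughout:

* pairs are exponents of `(x₁, x₂)`, or of `(z, x₂)` after the substitution `x₁ = x₂ e^z`
  (in the commutator formula the second variable is called `x` instead of `x₂`);
* triples are exponents of `(x₀, x₁, x₂)`.
-/

namespace FormalCalc

/-- The product of a scalar series and an `M`-valued series, with exponents in the group `Γ`. In all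
products below every coefficient is a sum with only finitely many nonzero terms. -/
def mul {Γ M : Type*} [AddCommGroup Γ] [AddCommGroup M] [Module ℂ M]
    (a : Γ → ℂ) (A : Γ → M) : Γ → M :=
  fun n => ∑ᶠ m : Γ, a m • A (n - m)

/-- `(s x + t y)ⁿ` for `n ∈ ℤ`, expanded in nonnegative powers of `y`: the series
`∑_{i ≥ 0} binom(n, i) (s x)^(n-i) (t y)^i`. The argument `(p, q)` is the pair of exponents of
`x` and `y`. -/
def binomPow (s t : ℂ) (n : ℤ) : ℤ × ℤ → ℂ :=
  fun e => if 0 ≤ e.2 ∧ e.1 + e.2 = n then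
    ((Ring.choose n e.2.toNat : ℤ) : ℂ) * s ^ e.1 * t ^ e.2 else 0

/-- `F(s x + t y) = ∑ₙ Fₙ (s x + t y)ⁿ` for `F ∈ ℂ((z))`, expanded in nonnegative powers of `y`:
only `n = p + q` contributes to the monomial `x^p y^q`. -/
def substSum (s t : ℂ) (F : ℂ⸨X⸩) : ℤ × ℤ → ℂ :=
  fun e => F.coeff (e.1 + e.2) * binomPow s t (e.1 + e.2) e

/-- `F(x₁ / x₂) ∈ ℂ((x₂))((x₁))` for `F ∈ ℂ((z))`. -/
def substRatio (F : ℂ⸨X⸩) : ℤ × ℤ → ℂ :=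
  fun e => if e.1 + e.2 = 0 then F.coeff e.1 else 0

/-- `p(x₁ / x₂)` for a polynomial `p`. -/
def polyRatio (p : Polynomial ℂ) : ℤ × ℤ → ℂ :=
  substRatio (((p : ℂ⟦X⟧) : ℂ⸨X⸩))

/-- `ι_{x₂,x₁}(f(x₁ / x₂))` for a rational function `f`: the expansion of `f(x₁ / x₂)` in
`ℂ((x₂))((x₁))`, obtained from the Laurent expansion of `f` at `0`. -/
def ratRatio (f : RatFunc ℂ) : ℤ × ℤ → ℂ :=
  substRatio (f : ℂ⸨X⸩)

/-- `p(e^z) ∈ ℂ[[z]]` for a polynomial `p`. -/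
def polyExp (p : Polynomial ℂ) : ℂ⟦X⟧ :=
  Polynomial.aeval (PowerSeries.exp ℂ) p

/-- `f(e^z) ∈ ℂ((z))` for a rational function `f`. -/
def ratExp (f : RatFunc ℂ) : ℂ⸨X⸩ :=
  ((polyExp f.num : ℂ⟦X⟧) : ℂ⸨X⸩) / ((polyExp f.denom : ℂ⟦X⟧) : ℂ⸨X⸩)

/-- `ι_{x₂,x₁}(f(e^(x₁ - x₂)))` for a rational function `f`: the element of `ℂ((x₂))[[x₁]]` that is
obtained from `f(e^z)` by substituting `z = -x₂ + x₁`. -/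
def ratExpDiff (f : RatFunc ℂ) : ℤ × ℤ → ℂ :=
  fun e => substSum (-1) 1 (ratExp f) (e.2, e.1)

/-- `f(x₂ - x₁)` for `f ∈ ℂ((z))`, expanded in nonnegative powers of `x₁`. -/
def laurentDiff (f : ℂ⸨X⸩) : ℤ × ℤ → ℂ :=
  fun e => substSum 1 (-1) f (e.2, e.1)

/-- `(x₁ - x₂)^k` for a natural number `k`. -/
def diffPow (k : ℕ) : ℤ × ℤ → ℂ := binomPow 1 (-1) k

/-- A power series in `z`, as a series in `(z, x₂)`. -/
def inFirst (F : ℂ⟦X⟧) : ℤ × ℤ → ℂ :=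
  fun e => if e.2 = 0 then (F : ℂ⸨X⸩).coeff e.1 else 0

/-- A series in `(x₁, x₂)`, as a series in `(x₀, x₁, x₂)`. -/
def in12 {M : Type*} [Zero M] (A : ℤ × ℤ → M) : ℤ × ℤ × ℤ → M :=
  fun e => if e.1 = 0 then A e.2 else 0

/-- A series in `(x₀, x₂)`, as a series in `(x₀, x₁, x₂)`. -/
def in02 {M : Type*} [Zero M] (A : ℤ × ℤ → M) : ℤ × ℤ × ℤ → M :=
  fun e => if e.2.1 = 0 then A (e.1, e.2.2) else 0

/-- `x₀⁻¹ δ((x₁ - x₂) / x₀) = ∑ₙ x₀^(-n-1) (x₁ - x₂)ⁿ`. -/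
def delta1 : ℤ × ℤ × ℤ → ℂ := fun e => binomPow 1 (-1) (-e.1 - 1) (e.2.1, e.2.2)

/-- `x₀⁻¹ δ((x₂ - x₁) / (-x₀)) = ∑ₙ x₀^(-n-1) (-x₂ + x₁)ⁿ`. -/
def delta2 : ℤ × ℤ × ℤ → ℂ := fun e => binomPow (-1) 1 (-e.1 - 1) (e.2.2, e.2.1)

/-- `x₂⁻¹ δ((x₁ - x₀) / x₂) = ∑ₙ x₂^(-n-1) (x₁ - x₀)ⁿ`. -/
def delta3 : ℤ × ℤ × ℤ → ℂ := fun e => binomPow 1 (-1) (-e.2.2 - 1) (e.2.1, e.1)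

/-- `δ(lam x / x₁) = ∑ₙ lamⁿ xⁿ x₁^(-n)`. -/
def deltaScaled (lam : ℂ) : ℤ × ℤ → ℂ :=
  fun e => if e.1 + e.2 = 0 then lam ^ e.2 else 0

/-- The Euler operator `x ∂/∂x` on series in `(x₁, x)`. -/
def euler (A : ℤ × ℤ → ℂ) : ℤ × ℤ → ℂ := fun e => (e.2 : ℂ) * A e

/-- `e^(x₀ x ∂/∂x) A = ∑_{j ≥ 0} (x₀^j / j!) (x ∂/∂x)^j A`, a series in `(x₀, x₁, x)`. -/
def expEuler (A : ℤ × ℤ → ℂ) : ℤ × ℤ × ℤ → ℂ :=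
  fun e => if 0 ≤ e.1 then ((e.1.toNat.factorial : ℂ))⁻¹ * (euler^[e.1.toNat] A) e.2 else 0

/-- The residue in `x₀`: the coefficient of `x₀⁻¹`. -/
def res0 {M : Type*} (A : ℤ × ℤ × ℤ → M) : ℤ × ℤ → M := fun e => A (-1, e)

/-- Membership in `M((x₁, x₂))`: the exponents of both variables are bounded below. -/
def IsLaurent {M : Type*} [Zero M] (A : ℤ × ℤ → M) : Prop :=
  ∃ N : ℤ, ∀ e : ℤ × ℤ, A e ≠ 0 → N ≤ e.1 ∧ N ≤ e.2

/-- The substitution `A(x₁, x₂) ↦ A(x₂ e^z, x₂)` for `A ∈ M((x₁, x₂))`: each monomial `x₁^m x₂^n`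
goes to `x₂^(m+n) ∑_{j ≥ 0} m^j z^j / j!`. The result is a series in `(z, x₂)`. -/
def substExp {M : Type*} [AddCommGroup M] [Module ℂ M] (A : ℤ × ℤ → M) : ℤ × ℤ → M :=
  fun e => if 0 ≤ e.1 then
    ∑ᶠ m : ℤ, ((m : ℂ) ^ e.1.toNat / (e.1.toNat.factorial : ℂ)) • A (m, e.2 - m) else 0

/-- `a(x₁) b(x₂) w`, as a series in `(x₁, x₂)`. -/
def prod12 {W : Type*} [AddCommGroup W] [Module ℂ W] (a b : VertexOperator ℂ W) (w : W) :
    ℤ × ℤ → W :=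
  fun e => HVertexOperator.coeff a e.1 (HVertexOperator.coeff b e.2 w)

/-- `b(x₂) a(x₁) w`, as a series in `(x₁, x₂)`. -/
def prod21 {W : Type*} [AddCommGroup W] [Module ℂ W] (b a : VertexOperator ℂ W) (w : W) :
    ℤ × ℤ → W :=
  fun e => HVertexOperator.coeff b e.2 (HVertexOperator.coeff a e.1 w)

/-- `Y_W(Y(u, x₀) v, x₂) w`, as a series in `(x₀, x₂)`. -/
def iterate {V W : Type*} [AddCommGroup V] [Module ℂ V] [AddCommGroup W] [Module ℂ W]
    (Y : V →ₗ[ℂ] VertexOperator ℂ V) (YW : V →ₗ[ℂ] VertexOperator ℂ W) (u v : V) (w : W) :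
    ℤ × ℤ → W :=
  fun e => HVertexOperator.coeff (YW (HVertexOperator.coeff (Y u) e.1 v)) e.2 w

end FormalCalc

open FormalCalc in
/-- A weak quantum vertex algebra structure on the complex vector space `V`. Here
`VertexOperator ℂ V` is `Hom(V, V((x)))`, and `HVertexOperator.coeff a n` is the coefficient of
`xⁿ` in `a`. -/
structure WeakQuantumVertexAlgebra (V : Type*) [AddCommGroup V] [Module ℂ V] where
  /-- The adjoint vertex operator map `Y(·, x)`. -/
  Y : V →ₗ[ℂ] VertexOperator ℂ V
  /-- The vacuum vector. -/
  vac : V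
  /-- `Y(1, x) v = v`. -/
  vac_coeff : ∀ (n : ℤ) (v : V), HVertexOperator.coeff (Y vac) n v = if n = 0 then v else 0
  /-- `Y(v, x) 1 ∈ V[[x]]`. -/
  creation_neg : ∀ (v : V) (n : ℤ), n < 0 → HVertexOperator.coeff (Y v) n vac = 0
  /-- The constant term of `Y(v, x) 1` is `v`. -/
  creation_zero : ∀ v : V, HVertexOperator.coeff (Y v) 0 vac = v
  /-- The `S`-Jacobi identity. -/
  sJacobi : ∀ u v : V, ∃ (r : ℕ) (u' v' : Fin r → V) (f : Fin r → ℂ⸨X⸩), ∀ w : V,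
    mul delta1 (in12 (prod12 (Y u) (Y v) w))
      - mul delta2 (in12 (∑ i, mul (laurentDiff (f i)) (prod21 (Y (v' i)) (Y (u' i)) w)))
    = mul delta3 (in02 (iterate Y Y u v w))

namespace WeakQuantumVertexAlgebra

open FormalCalc

variable {V : Type*} [AddCommGroup V] [Module ℂ V] (A : WeakQuantumVertexAlgebra V)

/-- The trigonometric `S`-locality relation
`(x₁ - x₂)^k Y(u, x₁) Y(v, x₂)
  = (x₁ - x₂)^k ∑ᵢ ι_{x₂,x₁}(fᵢ(e^(x₁ - x₂))) Y(v⁽ⁱ⁾, x₂) Y(u⁽ⁱ⁾, x₁)`. -/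
def TrigSLocal (u v : V) {r : ℕ} (u' v' : Fin r → V) (f : Fin r → RatFunc ℂ) (k : ℕ) : Prop :=
  ∀ w : V, mul (diffPow k) (prod12 (A.Y u) (A.Y v) w)
    = mul (diffPow k) (∑ i, mul (ratExpDiff (f i)) (prod21 (A.Y (v' i)) (A.Y (u' i)) w))

/-- `V` is of T-type: any two vectors satisfy a trigonometric `S`-locality relation. -/
def IsTType : Prop :=
  ∀ u v : V, ∃ (r : ℕ) (u' v' : Fin r → V) (f : Fin r → RatFunc ℂ) (k : ℕ),
    A.TrigSLocal u v u' v' f k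

/-- The automorphism group: bijective linear maps `σ` with `σ 1 = 1` and
`σ (Y(u, x) v) = Y(σ u, x) σ v`. -/
def aut : Subgroup (V ≃ₗ[ℂ] V) where
  carrier := {σ | σ A.vac = A.vac ∧ ∀ (u v : V) (n : ℤ),
    σ (HVertexOperator.coeff (A.Y u) n v) = HVertexOperator.coeff (A.Y (σ u)) n (σ v)}
  mul_mem' := by
    rintro σ τ ⟨hσ, hσ'⟩ ⟨hτ, hτ'⟩
    refine ⟨?_, fun u v n => ?_⟩
    · rw [LinearEquiv.mul_apply, hτ, hσ]
    · simp only [LinearEquiv.mul_apply, hτ', hσ']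
  one_mem' := ⟨rfl, fun _ _ _ => rfl⟩
  inv_mem' := by
    rintro σ ⟨hσ, hσ'⟩
    have key : ∀ x, σ (σ⁻¹ x) = x := fun x => σ.apply_symm_apply x
    refine ⟨?_, fun u v n => ?_⟩
    · apply σ.injective
      rw [key, hσ]
    · apply σ.injective
      rw [key, hσ', key, key]

/-- A `φ`-coordinated quasi module structure on the complex vector space `W`. -/
structure PhiQuasiModule (W : Type*) [AddCommGroup W] [Module ℂ W] where
  /-- The map `Y_W(·, x) : V → Hom(W, W((x)))`. -/
  Y : V →ₗ[ℂ] VertexOperator ℂ W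
  /-- `Y_W(1, x)` is the identity operator. -/
  vac_coeff : ∀ (n : ℤ) (w : W), HVertexOperator.coeff (Y A.vac) n w = if n = 0 then w else 0
  /-- There is a nonzero polynomial `p` with
  `p(x₁/x₂) Y_W(u, x₁) Y_W(v, x₂) ∈ Hom(W, W((x₁, x₂)))` and
  `p(e^z) Y_W(Y(u, z) v, x₂) = (p(x₁/x₂) Y_W(u, x₁) Y_W(v, x₂))|_{x₁ = x₂ e^z}`. -/
  phi_assoc : ∀ u v : V, ∃ p : Polynomial ℂ, p ≠ 0 ∧ ∀ w : W,
    IsLaurent (mul (polyRatio p) (prod12 (Y u) (Y v) w)) ∧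
    mul (inFirst (polyExp p)) (iterate A.Y Y u v w)
      = substExp (mul (polyRatio p) (prod12 (Y u) (Y v) w))

namespace PhiQuasiModule

variable {A} {W : Type*} [AddCommGroup W] [Module ℂ W] (M : A.PhiQuasiModule W)

/-- `M` is `G`-covariant for the action `ρ` of `G` on `V` by automorphisms and the linear
character `χ` of `G`. -/
structure IsCovariant {G : Type*} [Group G] (ρ : G →* A.aut) (χ : G →* ℂˣ) : Prop where
  /-- `Y_W(g v, x) = Y_W(v, χ(g) x)`. -/
  covariant : ∀ (g : G) (v : V) (n : ℤ) (w : W),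
    HVertexOperator.coeff (M.Y ((ρ g : V ≃ₗ[ℂ] V) v)) n w
      = (χ g : ℂ) ^ n • HVertexOperator.coeff (M.Y v) n w
  /-- There is a nonzero polynomial `p` all of whose zeros lie in `χ(G)` with
  `p(x₁/x₂) Y_W(u, x₁) Y_W(v, x₂) ∈ Hom(W, W((x₁, x₂)))`. -/
  quasi_compatible : ∀ u v : V, ∃ p : Polynomial ℂ, p ≠ 0 ∧
    (∀ z : ℂ, p.eval z = 0 → ∃ g : G, (χ g : ℂ) = z) ∧
    ∀ w : W, IsLaurent (mul (polyRatio p) (prod12 (M.Y u) (M.Y v) w))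

/-- The left side of the commutator formula,
`Y_W(u, x₁) Y_W(v, x) - ∑ᵢ ι_{x,x₁}(fᵢ(x₁ / x)) Y_W(v⁽ⁱ⁾, x) Y_W(u⁽ⁱ⁾, x₁)`,
applied to `w`; a series in `(x₁, x)`. -/
def twistedCommutator (u v : V) {r : ℕ} (u' v' : Fin r → V) (f : Fin r → RatFunc ℂ) :
    W → ℤ × ℤ → W :=
  fun w => prod12 (M.Y u) (M.Y v) w
    - ∑ i, mul (ratRatio (f i)) (prod21 (M.Y (v' i)) (M.Y (u' i)) w)

/-- `Res_{x₀} Y_W(Y(a, x₀) v, x) e^(x₀ x ∂/∂x) δ(lam x / x₁)`, applied to `w`; a series in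
`(x₁, x)`. -/
def deltaTerm (a v : V) (lam : ℂ) : W → ℤ × ℤ → W :=
  fun w => res0 (mul (expEuler (deltaScaled lam)) (in02 (iterate A.Y M.Y a v w)))

end PhiQuasiModule

end WeakQuantumVertexAlgebra

end

/-!
# The commutator formula for covariant `φ`-coordinated quasi modules

Fix `w ∈ W`, a linear functional `φ` on `W` and a total degree `N`, and put `t = x₁ / x`. By
`φ`-associativity, the part of degree `N` of `φ(Y_W(u, x₁) Y_W(v, x) w)` is the expansion at `t = ∞`
of a rational function `R(t)`, the correlation function, whose expansion at `t = 1` in the coordinate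
`z` with `t = e^z` gives `φ(Y_W(Y(u, z) v, x) w)` (`exists_isCorrelation`). The commutator formula is
the residue theorem for `R`, in three steps.

* The products `Y_W(v⁽ⁱ⁾, x) Y_W(u⁽ⁱ⁾, x₁)`, multiplied by `fᵢ(x₁ / x)` and summed, give the expansion
  of the *same* `R` at `t = 0`. As the expansion at `t = 1` is injective, it suffices to know this for
  the iterates, where it is a form of skew symmetry in `V`: `Y(u, z) v` equals
  `∑ fᵢ(e^z) e^(z D) Y(v⁽ⁱ⁾, -z) u⁽ⁱ⁾`. Only the values under the functional `ψ(a) = φ(a_N w)` are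
  needed, for which `ψ ∘ e^(z D) = e^(N z) ψ`, and so the relation can be read off from the locality
  relation and the Jacobi identity on the vacuum (`IsExponential.skew`, `IsCorrelation.skew`).
* Hence the commutator is the difference of the expansions of `R` at `∞` and at `0`, and the residue
  theorem `expandInfty_sub_expandZero` writes the coefficients of this difference as sums of residues
  at the poles of `R` in `ℂˣ`. It is proved by partial fractions, and by computing the residues of
  `(e^z - 1)^(-n)`. By quasi-compatibility the poles lie in `χ(G)`.
* By covariance, `R(χ(g) t)` is the correlation function of `g u` and `v`, so the expansion of `R` at
  `t = χ(g)` is given by `Y_W(Y(g u, z) v, x)`, and the residue at `χ(g)` is the delta term of `g`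
  (`IsCorrelation.map_deltaTerm`). Delta terms at points that are not poles vanish.
-/

noncomputable section

namespace FormalCalc

/-! ### Expansions of rational functions -/

theorem C_mul_coeff (c : ℂ) (F : ℂ⸨X⸩) (n : ℤ) :
    (HahnSeries.C c * F).coeff n = c * F.coeff n := by
  rw [HahnSeries.C_mul_eq_smul, HahnSeries.coeff_smul, smul_eq_mul]

theorem C_coeff_of_ne (c : ℂ) {n : ℤ} (hn : n ≠ 0) : (HahnSeries.C c : ℂ⸨X⸩).coeff n = 0 := by
  rw [HahnSeries.C_apply, HahnSeries.coeff_single_of_ne hn]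

/-- A Laurent series that is not constant is not a root of any nonzero polynomial. -/
theorem eval₂_ne_zero {τ : ℂ⸨X⸩} {n : ℤ} (hn : n ≠ 0) (h : τ.coeff n ≠ 0)
    {p : Polynomial ℂ} (hp : p ≠ 0) : p.eval₂ HahnSeries.C τ ≠ 0 := by
  rw [(IsAlgClosed.splits p).eq_prod_roots, ← Polynomial.coe_eval₂RingHom, map_mul,
    map_multiset_prod, Multiset.map_map]
  refine mul_ne_zero (by simpa using hp) (Multiset.prod_ne_zero ?_)
  rw [Multiset.mem_map]
  rintro ⟨a, -, ha⟩
  apply h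
  have : τ = HahnSeries.C a := by simpa [sub_eq_zero] using ha
  rw [this, C_coeff_of_ne a hn]

/-- The substitution `f ↦ f(τ)` of a nonconstant Laurent series `τ` into rational functions. -/
def ratSubst (τ : ℂ⸨X⸩) (hτ : ∃ n : ℤ, n ≠ 0 ∧ τ.coeff n ≠ 0) : RatFunc ℂ →+* ℂ⸨X⸩ :=
  RatFunc.liftRingHom (Polynomial.eval₂RingHom HahnSeries.C τ) (by
    obtain ⟨n, hn, h⟩ := hτ
    intro p hp
    exact mem_nonZeroDivisors_of_ne_zero (eval₂_ne_zero hn h (nonZeroDivisors.ne_zero hp)))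

theorem ratSubst_algebraMap (τ : ℂ⸨X⸩) (hτ) (p : Polynomial ℂ) :
    ratSubst τ hτ (algebraMap _ _ p) = p.eval₂ HahnSeries.C τ := by
  rw [ratSubst, RatFunc.liftRingHom_algebraMap, Polynomial.coe_eval₂RingHom]

@[simp]
theorem ratSubst_X (τ : ℂ⸨X⸩) (hτ) : ratSubst τ hτ RatFunc.X = τ := by
  rw [← RatFunc.algebraMap_X, ratSubst_algebraMap, Polynomial.eval₂_X]

@[simp]
theorem ratSubst_C (τ : ℂ⸨X⸩) (hτ) (c : ℂ) : ratSubst τ hτ (RatFunc.C c) = HahnSeries.C c := by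
  rw [← RatFunc.algebraMap_C, ratSubst_algebraMap, Polynomial.eval₂_C]

theorem ratFunc_ringHom_ext {K : Type*} [Field K] {f g : RatFunc ℂ →+* K}
    (hC : ∀ c, f (RatFunc.C c) = g (RatFunc.C c)) (hX : f RatFunc.X = g RatFunc.X) : f = g := by
  apply IsLocalization.ringHom_ext (nonZeroDivisors (Polynomial ℂ))
  apply Polynomial.ringHom_ext
  · intro c
    simpa using hC c
  · simpa using hX

/-- The expansion of a rational function at `0`. -/
def expandZero : RatFunc ℂ →+* ℂ⸨X⸩ :=
  ratSubst (HahnSeries.single 1 1) ⟨1, one_ne_zero, by simp⟩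

open scoped RatFunc in
theorem expandZero_apply (F : RatFunc ℂ) : expandZero F = (F : ℂ⸨X⸩) := by
  suffices h : expandZero = algebraMap (RatFunc ℂ) ℂ⸨X⸩ by rw [h]
  apply ratFunc_ringHom_ext
  · intro c
    have := RatFunc.coe_coe (Polynomial.C c)
    rw [RatFunc.coePolynomial_eq_algebraMap, RatFunc.algebraMap_C, Polynomial.coe_C,
      PowerSeries.coe_C] at this
    rw [← this, expandZero, ratSubst_C]
  · rw [RatFunc.coe_X, expandZero, ratSubst_X]

/-- The expansion of a rational function `f(t)` at `∞`, as a Laurent series in `t⁻¹`. -/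
def expandInfty : RatFunc ℂ →+* ℂ⸨X⸩ :=
  ratSubst (HahnSeries.single (-1) 1) ⟨-1, by norm_num, by simp⟩

theorem single_mul_coeff (k : ℤ) (F : ℂ⸨X⸩) (m : ℤ) :
    (HahnSeries.single k (1 : ℂ) * F).coeff m = F.coeff (m - k) := by
  have := HahnSeries.coeff_single_mul_add (r := (1 : ℂ)) (x := F) (a := m - k) (b := k)
  rwa [sub_add_cancel, one_mul] at this

/-- The substitution `F(X) ↦ F(cX)` in Laurent series. -/
def dilate (c : ℂˣ) : ℂ⸨X⸩ →+* ℂ⸨X⸩ where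
  toFun F := ⟨fun n => ((c ^ n : ℂˣ) : ℂ) * F.coeff n, F.isPWO_support.mono fun n hn => by
    rw [Function.mem_support] at hn
    exact right_ne_zero_of_mul hn⟩
  map_zero' := by ext; simp
  map_one' := by
    ext n
    by_cases h : n = 0
    · simp [h]
    · simp [HahnSeries.coeff_one, h]
  map_add' F G := by ext n; simp [mul_add]
  map_mul' F G := by
    ext n
    simp only [HahnSeries.coeff_mul, Finset.mul_sum]
    refine Finset.sum_congr ?_ ?_
    · ext e
      have hc (m : ℤ) : (c : ℂ) ^ m ≠ 0 := zpow_ne_zero _ c.ne_zero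
      simp [Finset.mem_antidiagonal, hc]
    · intro e he
      rw [← (Finset.mem_antidiagonal.mp he).2.2, zpow_add, Units.val_mul]
      ring

@[simp]
theorem dilate_coeff (c : ℂˣ) (F : ℂ⸨X⸩) (n : ℤ) :
    (dilate c F).coeff n = ((c ^ n : ℂˣ) : ℂ) * F.coeff n := rfl

@[simp]
theorem dilate_single_zero (c : ℂˣ) (a : ℂ) :
    dilate c (HahnSeries.single 0 a) = HahnSeries.single 0 a := by
  ext n
  by_cases h : n = 0
  · simp [h]
  · rw [dilate_coeff, HahnSeries.coeff_single_of_ne h, mul_zero]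

/-- `e^z` as a Laurent series in `z`. -/
def lexp : ℂ⸨X⸩ := ((PowerSeries.exp ℂ : ℂ⟦X⟧) : ℂ⸨X⸩)

theorem lexp_coeff (n : ℕ) : lexp.coeff n = ((n.factorial : ℂ))⁻¹ := by
  rw [lexp, LaurentSeries.coeff_coe_powerSeries, PowerSeries.coeff_exp]
  simp

/-- The expansion of a rational function `f(t)` at `t = c`, in the coordinate `z` with
`t = c e^z`. -/
def expandExp (c : ℂˣ) : RatFunc ℂ →+* ℂ⸨X⸩ :=
  ratSubst (HahnSeries.C (c : ℂ) * lexp) ⟨1, one_ne_zero, by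
    rw [C_mul_coeff, show (1 : ℤ) = ((1 : ℕ) : ℤ) from rfl, lexp_coeff]
    simp⟩

theorem expandExp_one_algebraMap (p : Polynomial ℂ) :
    expandExp 1 (algebraMap _ _ p) = ((polyExp p : ℂ⟦X⟧) : ℂ⸨X⸩) := by
  rw [expandExp, ratSubst_algebraMap, polyExp, Polynomial.aeval_def, Polynomial.hom_eval₂, lexp,
    Units.val_one, map_one HahnSeries.C, one_mul]
  congr 1
  ext1 c
  simp [PowerSeries.algebraMap_eq]

theorem ratExp_eq (f : RatFunc ℂ) : ratExp f = expandExp 1 f := by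
  rw [ratExp, ← expandExp_one_algebraMap, ← expandExp_one_algebraMap, ← map_div₀,
    RatFunc.num_div_denom]

/-- The substitution `f(t) ↦ f(s)` of a nonconstant rational function `s` into rational
functions. -/
def ratComp (s : RatFunc ℂ) (hs : ∃ n : ℤ, n ≠ 0 ∧ (expandZero s).coeff n ≠ 0) :
    RatFunc ℂ →+* RatFunc ℂ :=
  RatFunc.liftRingHom (Polynomial.eval₂RingHom RatFunc.C s) (by
    obtain ⟨n, hn, h⟩ := hs
    intro p hp
    refine mem_nonZeroDivisors_of_ne_zero fun h0 =>
      eval₂_ne_zero hn h (nonZeroDivisors.ne_zero hp) ?_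
    rw [Polynomial.coe_eval₂RingHom] at h0
    have := congrArg expandZero h0
    rw [Polynomial.hom_eval₂, map_zero] at this
    rw [← this]
    congr 1
    ext1 c
    simp [expandZero])

@[simp]
theorem ratComp_X (s : RatFunc ℂ) (hs) : ratComp s hs RatFunc.X = s := by
  rw [← RatFunc.algebraMap_X, ratComp, RatFunc.liftRingHom_algebraMap,
    Polynomial.coe_eval₂RingHom, Polynomial.eval₂_X]

@[simp]
theorem ratComp_C (s : RatFunc ℂ) (hs) (c : ℂ) : ratComp s hs (RatFunc.C c) = RatFunc.C c := by
  rw [ratComp, RatFunc.liftRingHom_C, Polynomial.coe_eval₂RingHom, Polynomial.eval₂_C]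

/-- The substitution `f(t) ↦ f(t⁻¹)` in rational functions. -/
def ratInv : RatFunc ℂ →+* RatFunc ℂ :=
  ratComp RatFunc.X⁻¹ ⟨-1, by norm_num, by simp [expandZero]⟩

/-- The substitution `f(t) ↦ f(ct)` in rational functions. -/
def ratScale (c : ℂˣ) : RatFunc ℂ →+* RatFunc ℂ :=
  ratComp (RatFunc.C (c : ℂ) * RatFunc.X) ⟨1, one_ne_zero, by simp [expandZero]⟩

theorem expandZero_ratInv (F : RatFunc ℂ) : expandZero (ratInv F) = expandInfty F := by
  refine congrArg (fun h : RatFunc ℂ →+* ℂ⸨X⸩ => h F)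
    (ratFunc_ringHom_ext (f := expandZero.comp ratInv) (g := expandInfty) ?_ ?_)
  · intro c
    simp [expandZero, expandInfty, ratInv]
  · simp [expandZero, expandInfty, ratInv]

theorem expandInfty_ratScale (c : ℂˣ) (F : RatFunc ℂ) :
    expandInfty (ratScale c F) = dilate c⁻¹ (expandInfty F) := by
  refine congrArg (fun h : RatFunc ℂ →+* ℂ⸨X⸩ => h F)
    (ratFunc_ringHom_ext (f := expandInfty.comp (ratScale c))
      (g := (dilate c⁻¹).comp expandInfty) ?_ ?_)
  · intro a
    simp [expandInfty, ratScale]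
  · ext n
    simp only [expandInfty, ratScale, RingHom.comp_apply, ratComp_X, map_mul, ratSubst_C,
      ratSubst_X, C_mul_coeff, dilate_coeff]
    by_cases h : n = -1
    · simp [h]
    · simp [HahnSeries.coeff_single_of_ne h]

theorem expandExp_ratScale (c : ℂˣ) (F : RatFunc ℂ) :
    expandExp 1 (ratScale c F) = expandExp c F := by
  refine congrArg (fun h : RatFunc ℂ →+* ℂ⸨X⸩ => h F)
    (ratFunc_ringHom_ext (f := (expandExp 1).comp (ratScale c)) (g := expandExp c) ?_ ?_)
  · intro a
    simp [expandExp, ratScale]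
  · simp [expandExp, ratScale]

/-- `e^{-z}` is the inverse of `e^z`. -/
theorem dilate_neg_one_lexp : dilate (-1) lexp = lexp⁻¹ := by
  apply eq_inv_of_mul_eq_one_right
  have h := congrArg (HahnSeries.ofPowerSeries ℤ ℂ) (PowerSeries.exp_mul_exp_neg_eq_one (A := ℂ))
  rw [map_mul, map_one] at h
  rw [← h, lexp]
  congr 1
  ext n
  rw [dilate_coeff, PowerSeries.coeff_coe, PowerSeries.coeff_coe]
  split_ifs with hn
  · simp
  · lift n to ℕ using not_lt.mp hn
    simp [PowerSeries.evalNegHom, PowerSeries.coeff_rescale]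

theorem expandExp_ratInv (F : RatFunc ℂ) :
    expandExp 1 (ratInv F) = dilate (-1) (expandExp 1 F) := by
  refine congrArg (fun h : RatFunc ℂ →+* ℂ⸨X⸩ => h F)
    (ratFunc_ringHom_ext (f := (expandExp 1).comp ratInv)
      (g := (dilate (-1)).comp (expandExp 1)) ?_ ?_)
  · intro a
    simp [expandExp, ratInv]
  · simp [expandExp, ratInv, dilate_neg_one_lexp]

theorem lexp_zpow (m : ℤ) :
    lexp ^ m = ((PowerSeries.rescale (m : ℂ) (PowerSeries.exp ℂ) : ℂ⟦X⟧) : ℂ⸨X⸩) := by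
  have h (n : ℕ) : lexp ^ n =
      ((PowerSeries.rescale (n : ℂ) (PowerSeries.exp ℂ) : ℂ⟦X⟧) : ℂ⸨X⸩) := by
    rw [← PowerSeries.exp_pow_eq_rescale_exp, map_pow, lexp]
  obtain ⟨n, rfl | rfl⟩ := m.eq_nat_or_neg
  · rw [zpow_natCast, h, Int.cast_natCast]
  · rw [zpow_neg, zpow_natCast, h, inv_eq_iff_eq_inv]
    apply eq_inv_of_mul_eq_one_left
    rw [← map_mul, PowerSeries.exp_mul_exp_eq_exp_add]
    simp

/-- The coefficients of `e^{mz}`. -/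
theorem lexp_zpow_coeff (m : ℤ) (n : ℕ) :
    (lexp ^ m).coeff n = (m : ℂ) ^ n / (n.factorial : ℂ) := by
  rw [lexp_zpow, LaurentSeries.coeff_coe_powerSeries, PowerSeries.coeff_rescale,
    PowerSeries.coeff_exp]
  simp [div_eq_mul_inv]

theorem lexp_zpow_coeff_neg (m : ℤ) {n : ℤ} (hn : n < 0) : (lexp ^ m).coeff n = 0 := by
  rw [lexp_zpow, PowerSeries.coeff_coe, if_pos hn]

theorem expandZero_X_zpow (k : ℤ) : expandZero (RatFunc.X ^ k) = HahnSeries.single k 1 := by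
  rw [map_zpow₀, expandZero, ratSubst_X, ← RatFunc.single_zpow]

theorem expandInfty_X_zpow (k : ℤ) :
    expandInfty (RatFunc.X ^ k) = HahnSeries.single (-k) 1 := by
  rw [map_zpow₀, expandInfty, ratSubst_X, RatFunc.single_zpow (-k), RatFunc.single_zpow (-1),
    ← zpow_mul]
  simp

theorem expandExp_X_zpow (c : ℂˣ) (k : ℤ) :
    expandExp c (RatFunc.X ^ k) = HahnSeries.C ((c : ℂ) ^ k) * lexp ^ k := by
  rw [map_zpow₀, expandExp, ratSubst_X, mul_zpow, map_zpow₀]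

theorem expEuler_deltaScaled (c : ℂˣ) (a : ℕ) (m n : ℤ) :
    expEuler (deltaScaled c) (a, m, n) = if m + n = 0 then
      (HahnSeries.C ((c : ℂ) ^ (-m)) * lexp ^ (-m)).coeff a else 0 := by
  have h : ∀ (a : ℕ) (B : ℤ × ℤ → ℂ), (euler^[a] B) (m, n) = (n : ℂ) ^ a * B (m, n) := by
    intro a
    induction a with
    | zero => simp
    | succ a ih =>
      intro B
      rw [Function.iterate_succ_apply, ih, euler, pow_succ]
      ring
  rw [expEuler, if_pos (Int.natCast_nonneg a), h, deltaScaled, C_mul_coeff, lexp_zpow_coeff]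
  simp only [Int.toNat_natCast]
  split_ifs with h0
  · rw [show n = -m by omega]
    ring
  · simp

/-! ### The residue theorem -/

theorem coe_inv_powerSeries {φ : ℂ⟦X⟧} (h : PowerSeries.constantCoeff φ ≠ 0) :
    ((φ : ℂ⟦X⟧) : ℂ⸨X⸩)⁻¹ = ((φ⁻¹ : ℂ⟦X⟧) : ℂ⸨X⸩) := by
  rw [inv_eq_iff_eq_inv]
  apply eq_inv_of_mul_eq_one_left
  rw [← map_mul, PowerSeries.mul_inv_cancel _ h, map_one]

/-- If `h (e^z - 1) = z`, then the coefficient of `z^n` in `h^(n+1)` is `(-1)^n`: it is the residue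
of `(e^z - 1)^(-n-1)`. The product rule gives
`z (h^n)' + n z h^n + n h^(n+1) = n h^n`, and the coefficients of `z^n` give the recursion. -/
theorem coeff_pow_of_mul_exp_sub_one {h : ℂ⟦X⟧} (hh : h * (PowerSeries.exp ℂ - 1) = PowerSeries.X)
    (n : ℕ) : PowerSeries.coeff n (h ^ (n + 1)) = (-1) ^ n := by
  have hd : PowerSeries.derivative ℂ h * (PowerSeries.exp ℂ - 1) + h * PowerSeries.exp ℂ = 1 := by
    have := congrArg (PowerSeries.derivative ℂ) hh
    rw [Derivation.leibniz, map_sub, PowerSeries.derivative_exp] at this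
    simp only [smul_eq_mul, Derivation.map_one_eq_zero, sub_zero, PowerSeries.derivative_X] at this
    linear_combination this
  -- Multiply `hd` by `h` and replace `h (e^z - 1)` by `z`.
  have hd' : PowerSeries.X * PowerSeries.derivative ℂ h + PowerSeries.X * h + h ^ 2 = h := by
    linear_combination (-PowerSeries.derivative ℂ h - h) * hh + h * hd
  induction n with
  | zero =>
    have := congrArg PowerSeries.constantCoeff hd
    simpa using this
  | succ n ih =>
    have hp : PowerSeries.X * PowerSeries.derivative ℂ (h ^ (n + 1))
        + (n + 1 : ℕ) • (PowerSeries.X * h ^ (n + 1)) + (n + 1 : ℕ) • h ^ (n + 2)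
        = (n + 1 : ℕ) • h ^ (n + 1) := by
      rw [Derivation.leibniz_pow]
      simp only [nsmul_eq_mul, smul_eq_mul, Nat.add_sub_cancel]
      linear_combination ((n + 1 : ℕ) : ℂ⟦X⟧) * h ^ n * hd'
    -- The coefficient of `z^(n+1)` of the first term cancels against the right side.
    have hq := congrArg (PowerSeries.coeff (n + 1)) hp
    rw [map_add, map_add, map_nsmul, map_nsmul, map_nsmul, PowerSeries.coeff_succ_X_mul,
      PowerSeries.coeff_succ_X_mul, PowerSeries.coeff_derivative, ih] at hq
    simp only [nsmul_eq_mul] at hq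
    have hn : ((n + 1 : ℕ) : ℂ) ≠ 0 := by exact_mod_cast n.succ_ne_zero
    apply mul_left_cancel₀ hn
    push_cast at hq ⊢
    rw [pow_succ (-1 : ℂ)]
    linear_combination hq

/-- The difference of the expansions at `∞` and at `0` of a rational function, at exponent `0`,
minus the sum of the residues at the points of `Λ` of `f dt / t`. -/
def residueDefect (Λ : Finset ℂˣ) : RatFunc ℂ →+ ℂ where
  toFun F := (expandInfty F).coeff 0 - (expandZero F).coeff 0
    - ∑ c ∈ Λ, (expandExp c F).coeff (-1)
  map_zero' := by simp
  map_add' F G := by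
    simp only [map_add, HahnSeries.coeff_add, Finset.sum_add_distrib]
    ring

theorem residueDefect_C_mul (Λ : Finset ℂˣ) (a : ℂ) (F : RatFunc ℂ) :
    residueDefect Λ (RatFunc.C a * F) = a * residueDefect Λ F := by
  simp only [residueDefect, AddMonoidHom.coe_mk, ZeroHom.coe_mk, map_mul, expandInfty, expandZero,
    expandExp, ratSubst_C, C_mul_coeff, mul_sub, Finset.mul_sum]

theorem residueDefect_X_zpow (Λ : Finset ℂˣ) (k : ℤ) :
    residueDefect Λ (RatFunc.X ^ k) = 0 := by
  simp only [residueDefect, AddMonoidHom.coe_mk, ZeroHom.coe_mk, expandInfty_X_zpow,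
    expandZero_X_zpow, expandExp_X_zpow, C_mul_coeff]
  rw [Finset.sum_eq_zero fun c _ => by rw [lexp_zpow_coeff_neg k (by norm_num), mul_zero]]
  by_cases h : k = 0
  · simp [h]
  · rw [HahnSeries.coeff_single_of_ne (by omega), HahnSeries.coeff_single_of_ne (by omega)]
    simp

theorem expandInfty_pole (c : ℂˣ) (n : ℕ) :
    (expandInfty ((RatFunc.X - RatFunc.C (c : ℂ))⁻¹ ^ (n + 1))).coeff 0 = 0 := by
  have h : expandInfty (RatFunc.X - RatFunc.C (c : ℂ))⁻¹
      = ((PowerSeries.X * (1 - PowerSeries.C (c : ℂ) * PowerSeries.X)⁻¹ : ℂ⟦X⟧) : ℂ⸨X⸩) := by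
    rw [map_mul, ← coe_inv_powerSeries (by simp), map_inv₀, map_sub, expandInfty, ratSubst_X,
      ratSubst_C, map_sub, map_one (HahnSeries.ofPowerSeries ℤ ℂ), map_mul, PowerSeries.coe_C,
      PowerSeries.coe_X, RatFunc.single_zpow (-1), zpow_neg_one]
    have hX : (HahnSeries.single 1 1 : ℂ⸨X⸩) ≠ 0 := by simp
    generalize (HahnSeries.single 1 1 : ℂ⸨X⸩) = x at hX ⊢
    rw [show x⁻¹ - HahnSeries.C (c : ℂ) = x⁻¹ * (1 - HahnSeries.C (c : ℂ) * x) by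
      field_simp, mul_inv, inv_inv]
  rw [map_pow, h, ← map_pow, PowerSeries.coeff_coe]
  simp

theorem expandZero_pole (c : ℂˣ) (n : ℕ) :
    (expandZero ((RatFunc.X - RatFunc.C (c : ℂ))⁻¹ ^ n)).coeff 0 = (-(c : ℂ))⁻¹ ^ n := by
  have h : expandZero (RatFunc.X - RatFunc.C (c : ℂ))⁻¹
      = (((PowerSeries.X - PowerSeries.C (c : ℂ))⁻¹ : ℂ⟦X⟧) : ℂ⸨X⸩) := by
    rw [← coe_inv_powerSeries (by simp), map_inv₀, map_sub, expandZero, ratSubst_X,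
      ratSubst_C, map_sub, PowerSeries.coe_C, PowerSeries.coe_X]
  rw [map_pow, h, ← map_pow, PowerSeries.coeff_coe]
  simp

theorem expandExp_X_sub_C (c : ℂˣ) (a : ℂ) : expandExp c (RatFunc.X - RatFunc.C a)
    = ((PowerSeries.C (c : ℂ) * PowerSeries.exp ℂ - PowerSeries.C a : ℂ⟦X⟧) : ℂ⸨X⸩) := by
  rw [map_sub, expandExp, ratSubst_X, ratSubst_C, map_sub, map_mul, PowerSeries.coe_C,
    PowerSeries.coe_C, lexp]

theorem expandExp_pole_of_ne {c d : ℂˣ} (hcd : c ≠ d) (n : ℕ) :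
    (expandExp c ((RatFunc.X - RatFunc.C (d : ℂ))⁻¹ ^ n)).coeff (-1) = 0 := by
  rw [map_pow, map_inv₀, expandExp_X_sub_C, coe_inv_powerSeries, ← map_pow, PowerSeries.coeff_coe]
  · simp
  · simpa [sub_eq_zero, Units.val_inj] using hcd

theorem expandExp_pole_self (c : ℂˣ) (n : ℕ) :
    (expandExp c ((RatFunc.X - RatFunc.C (c : ℂ))⁻¹ ^ (n + 1))).coeff (-1)
      = (c : ℂ)⁻¹ ^ (n + 1) * (-1) ^ n := by
  obtain ⟨g, hg⟩ : (PowerSeries.X : ℂ⟦X⟧) ∣ PowerSeries.exp ℂ - 1 := by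
    rw [PowerSeries.X_dvd_iff]; simp
  have hg0 : PowerSeries.constantCoeff g ≠ 0 := by
    have := congrArg (PowerSeries.coeff 1) hg
    rw [show 1 = 0 + 1 from rfl, PowerSeries.coeff_succ_X_mul] at this
    rw [← PowerSeries.coeff_zero_eq_constantCoeff_apply, ← this]
    simp [PowerSeries.coeff_exp, PowerSeries.coeff_one]
  have hh : g⁻¹ * (PowerSeries.exp ℂ - 1) = PowerSeries.X := by
    rw [hg, mul_left_comm, PowerSeries.inv_mul_cancel _ hg0, mul_one]
  have h1 : expandExp c (RatFunc.X - RatFunc.C (c : ℂ))⁻¹ =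
      HahnSeries.C (c : ℂ)⁻¹ * (HahnSeries.single (-1) 1 * ((g⁻¹ : ℂ⟦X⟧) : ℂ⸨X⸩)) := by
    rw [map_inv₀, expandExp_X_sub_C, show PowerSeries.C (c : ℂ) * PowerSeries.exp ℂ
      - PowerSeries.C (c : ℂ) = PowerSeries.C (c : ℂ) * (PowerSeries.exp ℂ - 1) by ring, hg,
      map_mul, map_mul, PowerSeries.coe_C, PowerSeries.coe_X, mul_inv, mul_inv,
      coe_inv_powerSeries hg0, RatFunc.single_zpow (-1), zpow_neg_one, map_inv₀]
  rw [map_pow, h1, mul_pow, mul_pow, ← map_pow, C_mul_coeff, HahnSeries.single_pow,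
    ← map_pow (HahnSeries.ofPowerSeries ℤ ℂ), one_pow, ← coeff_pow_of_mul_exp_sub_one hh n]
  congr 1
  have := HahnSeries.coeff_single_mul_add (r := (1 : ℂ))
    (x := ((g⁻¹ ^ (n + 1) : ℂ⟦X⟧) : ℂ⸨X⸩)) (a := (n : ℤ)) (b := (n + 1) • (-1 : ℤ))
  rw [one_mul, LaurentSeries.coeff_coe_powerSeries] at this
  rw [← this]
  congr 1
  simp

theorem residueDefect_pole {Λ : Finset ℂˣ} {c : ℂˣ} (hc : c ∈ Λ) (n : ℕ) :
    residueDefect Λ ((RatFunc.X - RatFunc.C (c : ℂ))⁻¹ ^ (n + 1)) = 0 := by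
  simp only [residueDefect, AddMonoidHom.coe_mk, ZeroHom.coe_mk, expandInfty_pole, expandZero_pole]
  rw [Finset.sum_eq_single_of_mem c hc fun d _ hd => expandExp_pole_of_ne hd _,
    expandExp_pole_self, inv_neg, neg_pow (c : ℂ)⁻¹]
  ring

/-- **Residue theorem** for `f dt / t`, where all poles of `f` in `ℂˣ` lie in `Λ`. -/
theorem expandInfty_sub_expandZero {Λ : Finset ℂˣ} {p q : Polynomial ℂ} (hp : p ≠ 0)
    (hΛ : ∀ z : ℂ, p.eval z = 0 → z = 0 ∨ ∃ c ∈ Λ, (c : ℂ) = z) {F : RatFunc ℂ}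
    (hF : F * algebraMap _ _ p = algebraMap _ _ q) :
    (expandInfty F).coeff 0 - (expandZero F).coeff 0 = ∑ c ∈ Λ, (expandExp c F).coeff (-1) := by
  classical
  suffices h : residueDefect Λ F = 0 by
    simpa [residueDefect, sub_eq_zero] using h
  have hpoly (q : Polynomial ℂ) : residueDefect Λ (algebraMap _ _ q) = 0 := by
    rw [q.as_sum_range_C_mul_X_pow, map_sum, map_sum]
    refine Finset.sum_eq_zero fun i _ => ?_
    rw [map_mul, map_pow, RatFunc.algebraMap_C, RatFunc.algebraMap_X, residueDefect_C_mul,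
      ← zpow_natCast, residueDefect_X_zpow, mul_zero]
  have hne (z : ℂ) : (RatFunc.X - RatFunc.C z) ≠ 0 := by
    rw [← RatFunc.algebraMap_X, ← RatFunc.algebraMap_C, ← map_sub]
    exact RatFunc.algebraMap_ne_zero (Polynomial.X_sub_C_ne_zero z)
  obtain ⟨Q, R, hR, hQ⟩ :=
    Polynomial.mul_prod_pow_inverse_eq_quo_add_sum_rem_mul_pow_inverse (K := RatFunc ℂ)
      (s := p.roots.toFinset) (Polynomial.C p.leadingCoeff⁻¹ * q)
      (g := fun z : ℂ => Polynomial.X - Polynomial.C z)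
      (fun i _ => Polynomial.monic_X_sub_C i)
      (fun i _ j _ hij => Polynomial.isCoprime_X_sub_C_of_isUnit_sub
        (sub_ne_zero.mpr hij).isUnit)
      (fun z => p.rootMultiplicity z)
      (gi := fun z : ℂ => (RatFunc.X - RatFunc.C z)⁻¹)
      (fun z _ => by
        rw [map_sub, RatFunc.algebraMap_X, RatFunc.algebraMap_C, inv_mul_cancel₀ (hne z)])
  have hprod : algebraMap (Polynomial ℂ) (RatFunc ℂ) p = RatFunc.C p.leadingCoeff *
      ∏ z ∈ p.roots.toFinset, (RatFunc.X - RatFunc.C z) ^ p.rootMultiplicity z := by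
    conv_lhs => rw [(IsAlgClosed.splits p).eq_prod_roots, Finset.prod_multiset_map_count]
    rw [map_mul, map_prod, RatFunc.algebraMap_C]
    simp
  have hlc : RatFunc.C p.leadingCoeff ≠ 0 := by simpa using hp
  have hFQ : F = algebraMap (Polynomial ℂ) (RatFunc ℂ) (Polynomial.C p.leadingCoeff⁻¹ * q) *
      ∏ z ∈ p.roots.toFinset, (RatFunc.X - RatFunc.C z)⁻¹ ^ p.rootMultiplicity z := by
    have hP : (∏ z ∈ p.roots.toFinset, (RatFunc.X - RatFunc.C z) ^ p.rootMultiplicity z) ≠ 0 :=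
      Finset.prod_ne_zero_iff.mpr fun z _ => pow_ne_zero _ (hne z)
    simp only [inv_pow, Finset.prod_inv_distrib]
    rw [eq_mul_inv_iff_mul_eq₀ hP, map_mul, ← hF, hprod, RatFunc.algebraMap_C, map_inv₀]
    field_simp
  rw [hFQ, hQ, map_add, hpoly, zero_add, map_sum]
  refine Finset.sum_eq_zero fun z hz => ?_
  rw [map_sum]
  refine Finset.sum_eq_zero fun j _ => ?_
  have hd := hR z hz j
  -- The denominators are linear, so the numerators are constants.
  rw [Polynomial.degree_X_sub_C] at hd
  rw [Polynomial.eq_C_of_degree_le_zero (Nat.WithBot.lt_one_iff_le_zero.mp hd), RatFunc.algebraMap_C,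
    residueDefect_C_mul]
  have hz0 : p.eval z = 0 := by
    rw [Multiset.mem_toFinset, Polynomial.mem_roots hp] at hz
    exact hz
  obtain rfl | ⟨c, hc, rfl⟩ := hΛ z hz0
  · rw [map_zero, sub_zero, inv_pow, ← zpow_natCast, ← zpow_neg, residueDefect_X_zpow, mul_zero]
  · rw [residueDefect_pole hc, mul_zero]

/-! ### Products of formal series -/

theorem finsum_eq_finsum_comp {α β M : Type*} [AddCommMonoid M] {f : β → M} {g : α → β}
    (hg : Function.Injective g) (h : ∀ b, f b ≠ 0 → b ∈ Set.range g) :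
    ∑ᶠ b, f b = ∑ᶠ a, f (g a) := by
  rw [← finsum_mem_range hg, ← finsum_mem_univ]
  apply finsum_mem_inter_support_eq
  ext b
  simp only [Set.univ_inter, Set.mem_inter_iff, Function.mem_support]
  exact ⟨fun hb => ⟨h b hb, hb⟩, fun hb => hb.2⟩

section Hahn

variable {Γ M : Type*} [AddCommGroup Γ] [LinearOrder Γ] [IsOrderedAddMonoid Γ]
  [AddCommGroup M] [Module ℂ M]

theorem finite_support_mul (F : HahnSeries Γ ℂ) (G : HahnSeries Γ M) (n : Γ) :
    (Function.support fun m => F.coeff m • G.coeff (n - m)).Finite := by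
  refine ((Finset.antidiagonal F.isPWO_support G.isPWO_support n).image Prod.fst).finite_toSet.subset
    fun m hm => ?_
  rw [Function.mem_support] at hm
  rw [Finset.mem_coe, Finset.mem_image]
  exact ⟨(m, n - m), Finset.mem_antidiagonal.mpr ⟨left_ne_zero_of_smul hm,
    right_ne_zero_of_smul hm, by simp⟩, rfl⟩

theorem mul_coeff_coeff (F G : HahnSeries Γ ℂ) (n : Γ) :
    mul F.coeff G.coeff n = (F * G).coeff n := by
  rw [mul, HahnSeries.coeff_mul, finsum_eq_sum_of_support_subset
      (s := (Finset.antidiagonal F.isPWO_support G.isPWO_support n).image Prod.fst),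
    Finset.sum_image]
  · refine Finset.sum_congr rfl fun e he => ?_
    rw [← (Finset.mem_antidiagonal.mp he).2.2, add_sub_cancel_left, smul_eq_mul]
  · intro e he e' he' h
    have h1 := (Finset.mem_antidiagonal.mp he).2.2
    have h2 := (Finset.mem_antidiagonal.mp he').2.2
    ext
    · exact h
    · rw [← h2] at h1
      rw [h] at h1
      exact add_left_cancel h1
  · intro m hm
    rw [Function.mem_support] at hm
    rw [Finset.mem_coe, Finset.mem_image]
    exact ⟨(m, n - m), Finset.mem_antidiagonal.mpr ⟨left_ne_zero_of_smul hm,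
      right_ne_zero_of_smul hm, by simp⟩, rfl⟩

end Hahn

/-- The Laurent series with prescribed coefficients, all zero below some exponent. -/
def ofCoeff {M : Type*} [Zero M] (c : ℤ → M) (h : ∃ B : ℤ, ∀ n < B, c n = 0) : HahnSeries ℤ M :=
  HahnSeries.ofSuppBddBelow c (by
    obtain ⟨B, hB⟩ := h
    exact ⟨B, fun n hn => not_lt.mp fun h => hn (hB n h)⟩)

@[simp]
theorem ofCoeff_coeff {M : Type*} [Zero M] (c : ℤ → M) (h) : (ofCoeff c h).coeff = c := rfl

section Map

variable {Γ M : Type*} [AddCommGroup Γ] [AddCommGroup M] [Module ℂ M]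

theorem map_mul_apply (φ : M →ₗ[ℂ] ℂ) {a : Γ → ℂ} {A : Γ → M} {n : Γ}
    (h : (Function.support fun m => a m • A (n - m)).Finite) :
    φ (mul a A n) = mul a (fun m => φ (A m)) n := by
  rw [mul, mul]
  refine (φ.toAddMonoidHom.map_finsum h).trans ?_
  exact finsum_congr fun m => φ.map_smul _ _

theorem mul_substRatio (F : ℂ⸨X⸩) (A : ℤ × ℤ → M) (m n : ℤ) :
    mul (substRatio F) A (m, n) = ∑ᶠ k : ℤ, F.coeff k • A (m - k, n + k) := by
  rw [mul, finsum_eq_finsum_comp (g := fun k : ℤ => (k, -k))]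
  · refine finsum_congr fun k => ?_
    simp [substRatio]
  · intro a b h
    exact congrArg Prod.fst h
  · intro b hb
    have : b.1 + b.2 = 0 := by
      by_contra h
      rw [substRatio, if_neg h, zero_smul] at hb
      exact hb rfl
    exact ⟨b.1, Prod.ext rfl (by simp; omega)⟩

theorem mul_inFirst (F : ℂ⟦X⟧) (A : ℤ × ℤ → M) (m n : ℤ) :
    mul (inFirst F) A (m, n) = ∑ᶠ k : ℤ, (F : ℂ⸨X⸩).coeff k • A (m - k, n) := by
  rw [mul, finsum_eq_finsum_comp (g := fun k : ℤ => (k, 0))]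
  · refine finsum_congr fun k => ?_
    simp [inFirst]
  · intro a b h
    exact congrArg Prod.fst h
  · intro b hb
    have : b.2 = 0 := by
      by_contra h
      rw [inFirst, if_neg h, zero_smul] at hb
      exact hb rfl
    exact ⟨b.1, Prod.ext rfl this.symm⟩

theorem map_finsum_smul (φ : M →ₗ[ℂ] ℂ) (F : ℂ⸨X⸩) (c : ℤ → M) (h : ∃ B : ℤ, ∀ n < B, c n = 0)
    (h' : ∃ B : ℤ, ∀ n < B, φ (c n) = 0) (n : ℤ) :
    φ (∑ᶠ k, F.coeff k • c (n - k)) = (F * ofCoeff (fun n => φ (c n)) h').coeff n := by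
  rw [← mul_coeff_coeff]
  exact map_mul_apply φ (finite_support_mul F (ofCoeff c h) n)

end Map

theorem coeff_eq_zero_of_lt {V : Type*} [AddCommGroup V] [Module ℂ V] (a : VertexOperator ℂ V)
    (v : V) : ∃ B : ℤ, ∀ n < B, HVertexOperator.coeff a n v = 0 :=
  ⟨_, fun n hn => VertexOperator.coeff_eq_zero_of_lt_order a n v hn⟩

/-! ### Expansions of polynomials and Laurent polynomials -/

/-- On polynomials, the expansions at `∞` and at `0` differ only by the sign of the exponents. -/
theorem expandInfty_algebraMap_coeff (p : Polynomial ℂ) (k : ℤ) :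
    (expandInfty (algebraMap _ _ p)).coeff k = (((p : ℂ⟦X⟧) : ℂ⸨X⸩)).coeff (-k) := by
  have h : ((p : ℂ⟦X⟧) : ℂ⸨X⸩) = expandZero (algebraMap _ _ p) := by
    rw [expandZero_apply, RatFunc.coe_coe, RatFunc.coePolynomial_eq_algebraMap]
  rw [h]
  induction p using Polynomial.induction_on' with
  | add p q hp hq =>
    simp only [map_add, HahnSeries.coeff_add]
    rw [hp, hq] <;>
    rw [expandZero_apply, RatFunc.coe_coe, RatFunc.coePolynomial_eq_algebraMap]
  | monomial n a =>
    rw [← Polynomial.C_mul_X_pow_eq_monomial, map_mul, map_pow, RatFunc.algebraMap_C,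
      RatFunc.algebraMap_X, map_mul, map_mul, ← zpow_natCast, expandZero_X_zpow,
      expandInfty_X_zpow, expandZero, expandInfty, ratSubst_C, ratSubst_C, C_mul_coeff,
      C_mul_coeff]
    congr 1
    by_cases h : k = -n
    · simp [h]
    · rw [HahnSeries.coeff_single_of_ne (by omega), HahnSeries.coeff_single_of_ne (by omega)]

/-- A finite sum `∑ eᵢ tⁱ` as a rational function. -/
def laurentPoly (E : ℤ →₀ ℂ) : RatFunc ℂ := E.sum fun i a => RatFunc.C a * RatFunc.X ^ i

theorem expandInfty_laurentPoly (E : ℤ →₀ ℂ) (k : ℤ) :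
    (expandInfty (laurentPoly E)).coeff (-k) = E k := by
  induction E using Finsupp.induction_linear with
  | zero => simp [laurentPoly]
  | add f g hf hg =>
    rw [laurentPoly, Finsupp.sum_add_index' (by simp) (by intros; rw [map_add, add_mul]), map_add,
      HahnSeries.coeff_add, ← laurentPoly, ← laurentPoly, hf, hg, Finsupp.add_apply]
  | single i a =>
    rw [laurentPoly, Finsupp.sum_single_index (by simp), map_mul, expandInfty_X_zpow,
      expandInfty, ratSubst_C, C_mul_coeff]
    by_cases h : k = i
    · simp [h]
    · rw [HahnSeries.coeff_single_of_ne (by omega), Finsupp.single_eq_of_ne h, mul_zero]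

theorem expandExp_laurentPoly (E : ℤ →₀ ℂ) (n : ℕ) :
    (expandExp 1 (laurentPoly E)).coeff n = E.sum fun i a => (i : ℂ) ^ n / (n.factorial : ℂ) * a := by
  rw [laurentPoly, Finsupp.sum, map_sum, HahnSeries.coeff_sum]
  refine Finset.sum_congr rfl fun i _ => ?_
  rw [map_mul, expandExp_X_zpow, expandExp, ratSubst_C]
  simp [lexp_zpow_coeff, mul_comm]

theorem expandExp_laurentPoly_neg (E : ℤ →₀ ℂ) {n : ℤ} (hn : n < 0) :
    (expandExp 1 (laurentPoly E)).coeff n = 0 := by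
  rw [laurentPoly, Finsupp.sum, map_sum, HahnSeries.coeff_sum]
  refine Finset.sum_eq_zero fun i _ => ?_
  rw [map_mul, expandExp_X_zpow, expandExp, ratSubst_C]
  simp [lexp_zpow_coeff_neg i hn]

theorem exists_laurentPoly_mul_X_pow (E : ℤ →₀ ℂ) :
    ∃ (s : ℕ) (q : Polynomial ℂ), laurentPoly E * RatFunc.X ^ s = algebraMap _ _ q := by
  induction E using Finsupp.induction_linear with
  | zero => exact ⟨0, 0, by simp [laurentPoly]⟩
  | add f g hf hg =>
    obtain ⟨s, q, h⟩ := hf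
    obtain ⟨s', q', h'⟩ := hg
    refine ⟨s + s', q * Polynomial.X ^ s' + q' * Polynomial.X ^ s, ?_⟩
    rw [laurentPoly, Finsupp.sum_add_index' (by simp) (by intros; rw [map_add, add_mul]),
      ← laurentPoly, ← laurentPoly, map_add, map_mul, map_mul, ← h, ← h', map_pow, map_pow,
      RatFunc.algebraMap_X]
    ring
  | single i a =>
    refine ⟨i.natAbs, Polynomial.C a * Polynomial.X ^ (i + i.natAbs).toNat, ?_⟩
    rw [laurentPoly, Finsupp.sum_single_index (by simp), map_mul, map_pow, RatFunc.algebraMap_X,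
      RatFunc.algebraMap_C, mul_assoc, ← zpow_natCast, ← zpow_natCast,
      ← zpow_add₀ RatFunc.X_ne_zero, Int.toNat_of_nonneg (by omega)]

end FormalCalc

namespace WeakQuantumVertexAlgebra.PhiQuasiModule

open FormalCalc

variable {V W : Type*} [AddCommGroup V] [Module ℂ V] [AddCommGroup W] [Module ℂ W]
  {A : WeakQuantumVertexAlgebra V} (M : A.PhiQuasiModule W)

/-! ### Correlation functions -/

/-- `R` is the correlation function of `u`, `v` with respect to `φ` and `w` in total degree `N`:
with `t = x₁ / x₂`, the part of degree `N` of `φ(Y_W(u, x₁) Y_W(v, x₂) w)` is the expansion of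
`x₂^N R(t)` at `t = ∞`, and that of `φ(Y_W(Y(u, z) v, x₂) w)` is `x₂^N R(e^z)`. -/
structure IsCorrelation (φ : W →ₗ[ℂ] ℂ) (w : W) (N : ℤ) (u v : V) (R : RatFunc ℂ) : Prop where
  coeff_infty : ∀ m : ℤ,
    (expandInfty R).coeff (-m) = φ (prod12 (M.Y u) (M.Y v) w (m, N - m))
  coeff_exp : ∀ n : ℤ, (expandExp 1 R).coeff n = φ (iterate A.Y M.Y u v w (n, N))

variable (φ : W →ₗ[ℂ] ℂ) (w : W) (N : ℤ) (u v : V)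

/-- If `p(x₁/x₂) Y_W(u, x₁) Y_W(v, x₂) w` lies in `W((x₁, x₂))`, then each of its homogeneous parts
is a Laurent polynomial. -/
theorem exists_finsupp_coeff {p : Polynomial ℂ}
    (hL : IsLaurent (mul (polyRatio p) (prod12 (M.Y u) (M.Y v) w))) :
    ∃ E : ℤ →₀ ℂ, ∀ m, E m = φ (mul (polyRatio p) (prod12 (M.Y u) (M.Y v) w) (m, N - m)) := by
  obtain ⟨B, hB⟩ := hL
  refine ⟨Finsupp.onFinset (Finset.Icc B (N - B)) _ fun m hm => ?_, fun m => rfl⟩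
  have := hB (m, N - m) fun h => hm ((congrArg φ h).trans (map_zero φ))
  rw [Finset.mem_Icc]
  simp only at this
  omega

theorem expandInfty_mul_prod12 (p : Polynomial ℂ) (m : ℤ) (h) :
    φ (mul (polyRatio p) (prod12 (M.Y u) (M.Y v) w) (m, N - m))
      = (expandInfty (algebraMap _ _ p) *
        ofCoeff (fun k => φ (prod12 (M.Y u) (M.Y v) w (-k, N + k))) h).coeff (-m) := by
  rw [← mul_coeff_coeff, polyRatio, mul_substRatio, mul]
  have hfin : (Function.support fun k : ℤ => (((p : ℂ⟦X⟧) : ℂ⸨X⸩)).coeff k •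
      prod12 (M.Y u) (M.Y v) w (m - k, N - m + k)).Finite := by
    refine (Finset.Icc (0 : ℤ) p.natDegree).finite_toSet.subset fun k hk => ?_
    have hk' := left_ne_zero_of_smul (Function.mem_support.mp hk)
    rw [PowerSeries.coeff_coe] at hk'
    split_ifs at hk' with h0
    · exact absurd rfl hk'
    · rw [Polynomial.coeff_coe] at hk'
      have := Polynomial.le_natDegree_of_ne_zero hk'
      rw [Finset.mem_coe, Finset.mem_Icc]
      omega
  refine (φ.toAddMonoidHom.map_finsum hfin).trans ?_
  symm
  rw [finsum_eq_finsum_comp (g := fun k : ℤ => -k) neg_injective fun b _ => ⟨-b, neg_neg b⟩]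
  refine finsum_congr fun k => ?_
  rw [expandInfty_algebraMap_coeff, neg_neg, ofCoeff_coeff]
  refine Eq.trans ?_ (φ.map_smul _ _).symm
  rw [show -(-m - -k) = m - k by ring, show N + (-m - -k) = N - m + k by ring]

theorem prod12_bdd : ∃ B : ℤ, ∀ k < B, φ (prod12 (M.Y u) (M.Y v) w (-k, N + k)) = 0 := by
  obtain ⟨B, hB⟩ := coeff_eq_zero_of_lt (M.Y v) w
  exact ⟨B - N, fun k hk => by rw [prod12, hB (N + k) (by omega), map_zero, map_zero]⟩

theorem iterate_bdd : ∃ B : ℤ, ∀ n < B, iterate A.Y M.Y u v w (n, N) = 0 := by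
  obtain ⟨B, hB⟩ := coeff_eq_zero_of_lt (A.Y u) v
  refine ⟨B, fun n hn => ?_⟩
  rw [iterate, hB n hn, map_zero, map_zero]
  rfl

/-- Associativity says that `p(t) R(t)` is a Laurent polynomial for a suitable `p ≠ 0`. -/
theorem exists_isCorrelation : ∃ R, M.IsCorrelation φ w N u v R := by
  obtain ⟨p, hp, hM⟩ := M.phi_assoc u v
  obtain ⟨hL, hI⟩ := hM w
  obtain ⟨E, hE⟩ := M.exists_finsupp_coeff φ w N u v hL
  have hp' : algebraMap (Polynomial ℂ) (RatFunc ℂ) p ≠ 0 := RatFunc.algebraMap_ne_zero hp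
  have hbd := M.prod12_bdd φ w N u v
  have hbd' : ∃ B : ℤ, ∀ n < B, φ (iterate A.Y M.Y u v w (n, N)) = 0 := by
    obtain ⟨B, hB⟩ := M.iterate_bdd w N u v
    exact ⟨B, fun n hn => by rw [hB n hn, map_zero]⟩
  refine ⟨laurentPoly E / algebraMap _ _ p, ⟨fun m => ?_, fun n => ?_⟩⟩
  · have : expandInfty (laurentPoly E / algebraMap _ _ p) =
        ofCoeff (fun k => φ (prod12 (M.Y u) (M.Y v) w (-k, N + k))) hbd := by
      rw [map_div₀, div_eq_iff (by simpa using hp'), mul_comm]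
      ext k
      rw [← neg_neg k, expandInfty_laurentPoly, hE, M.expandInfty_mul_prod12 φ w N u v p _ hbd]
    rw [this, ofCoeff_coeff, neg_neg, sub_eq_add_neg]
  · have : expandExp 1 (laurentPoly E / algebraMap _ _ p) =
        ofCoeff (fun n => φ (iterate A.Y M.Y u v w (n, N))) hbd' := by
      rw [map_div₀, div_eq_iff (by simpa using hp'), mul_comm, expandExp_one_algebraMap]
      ext k
      have hk := congrFun hI (k, N)
      rw [mul_inFirst] at hk
      have hk' := congrArg φ hk
      rw [map_finsum_smul φ _ (fun n => iterate A.Y M.Y u v w (n, N)) (M.iterate_bdd w N u v)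
        hbd'] at hk'
      rw [hk', substExp]
      split_ifs with h0
      · lift k to ℕ using h0
        rw [expandExp_laurentPoly]
        simp only [Int.toNat_natCast]
        have hsupp : (Function.support fun m : ℤ => ((m : ℂ) ^ k / (k.factorial : ℂ)) •
            mul (polyRatio p) (prod12 (M.Y u) (M.Y v) w) (m, N - m)).Finite := by
          obtain ⟨B, hB⟩ := hL
          refine (Finset.Icc B (N - B)).finite_toSet.subset fun m hm => ?_
          have := hB _ (right_ne_zero_of_smul (Function.mem_support.mp hm))
          rw [Finset.mem_coe, Finset.mem_Icc]
          simp only at this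
          omega
        refine Eq.trans ?_ (φ.toAddMonoidHom.map_finsum hsupp).symm
        rw [finsum_eq_sum_of_support_subset (s := E.support)]
        · exact Finset.sum_congr rfl fun m _ =>
            ((φ.map_smul _ _).trans (by rw [← hE, smul_eq_mul])).symm
        · intro m hm
          rw [Finset.mem_coe, Finsupp.mem_support_iff, hE]
          intro h0
          refine Function.mem_support.mp hm ?_
          exact (φ.map_smul _ _).trans (by rw [h0, smul_zero])
      · rw [expandExp_laurentPoly_neg E (not_le.mp h0), map_zero]
    rw [this, ofCoeff_coeff]

variable {M φ w N u v}

/-- If `p(x₁/x₂) Y_W(u, x₁) Y_W(v, x₂) w` lies in `W((x₁, x₂))`, then the poles of the correlation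
function in `ℂˣ` are zeros of `p`. -/
theorem IsCorrelation.exists_mul_eq {R : RatFunc ℂ} (hR : M.IsCorrelation φ w N u v R)
    {p : Polynomial ℂ} (hL : IsLaurent (mul (polyRatio p) (prod12 (M.Y u) (M.Y v) w))) :
    ∃ E : ℤ →₀ ℂ, R * algebraMap _ _ p = laurentPoly E := by
  obtain ⟨E, hE⟩ := M.exists_finsupp_coeff φ w N u v hL
  refine ⟨E, expandInfty.injective ?_⟩
  have hbd := M.prod12_bdd φ w N u v
  ext k
  rw [← neg_neg k, expandInfty_laurentPoly, hE, M.expandInfty_mul_prod12 φ w N u v p _ hbd,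
    mul_comm, map_mul]
  congr 2
  ext j
  rw [ofCoeff_coeff, ← neg_neg j, hR.coeff_infty]
  simp only [neg_neg, sub_neg_eq_add]

end WeakQuantumVertexAlgebra.PhiQuasiModule

namespace FormalCalc

/-! ### Substitution of a difference into Laurent series -/

section Lex

variable {M : Type*} [AddCommGroup M] [Module ℂ M]

/-- An `M`-valued series in `(x₁, x₂)` whose exponents of `x₁` are bounded below and, for each
exponent of `x₁`, those of `x₂` are bounded below, as a Hahn series for the lexicographic order.
For `M = ℂ` these series form the field `ℂ((x₂))((x₁))`. -/
def lexSeries (A : ℤ × ℤ → M) (h₁ : ∃ B, ∀ e, A e ≠ 0 → B ≤ e.1)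
    (h₂ : ∀ m, ∃ B, ∀ n, A (m, n) ≠ 0 → B ≤ n) : HahnSeries (ℤ ×ₗ ℤ) M where
  coeff e := A (ofLex e)
  isPWO_support' := by
    apply Set.PartiallyWellOrderedOn.subsetProdLex
    · obtain ⟨B, hB⟩ := h₁
      refine (BddBelow.isWF ⟨B, ?_⟩).isPWO
      rintro _ ⟨e, he, rfl⟩
      exact hB _ he
    · intro m
      obtain ⟨B, hB⟩ := h₂ m
      exact (BddBelow.isWF ⟨B, fun n hn => hB n hn⟩).isPWO

theorem mul_eq_mul_toLex (a : ℤ × ℤ → ℂ) (A : ℤ × ℤ → M) (e : ℤ × ℤ) :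
    mul a A e = mul (Γ := ℤ ×ₗ ℤ) (fun e => a (ofLex e)) (fun e => A (ofLex e)) (toLex e) := rfl

/-- The product in the formal calculus agrees with the product of Hahn series. -/
theorem mul_coeff_toLex {a b : ℤ × ℤ → ℂ} {F G : HahnSeries (ℤ ×ₗ ℤ) ℂ}
    (ha : ∀ e, a e = F.coeff (toLex e)) (hb : ∀ e, b e = G.coeff (toLex e)) (e : ℤ × ℤ) :
    mul a b e = (F * G).coeff (toLex e) := by
  rw [← mul_coeff_coeff, mul_eq_mul_toLex]
  congr 1
  · funext e; exact ha _
  · funext e; exact hb _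

end Lex

theorem exists_le_of_coeff_ne_zero (F : ℂ⸨X⸩) : ∃ B : ℤ, ∀ n, F.coeff n ≠ 0 → B ≤ n :=
  ⟨F.order, fun _ hn => HahnSeries.order_le_of_coeff_ne_zero hn⟩

theorem substSum_eq (F : ℂ⸨X⸩) (p q : ℤ) : substSum (-1) 1 F (p, q) =
    if 0 ≤ q then F.coeff (p + q) * ((Ring.choose (p + q) q.toNat : ℤ) : ℂ) * (-1) ^ p else 0 := by
  rw [substSum, binomPow]
  by_cases hq : 0 ≤ q
  · simp [hq, mul_assoc]
  · simp [hq]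

/-- `F(-x₂ + x₁)`, expanded in nonnegative powers of `x₁`, as an element of `ℂ((x₂))((x₁))`. -/
def diffSeries (F : ℂ⸨X⸩) : HahnSeries (ℤ ×ₗ ℤ) ℂ :=
  lexSeries (fun e => substSum (-1) 1 F (e.2, e.1))
    ⟨0, fun e he => by
      by_contra h
      rw [substSum_eq, if_neg h] at he
      exact he rfl⟩
    (fun m => by
      obtain ⟨B, hB⟩ := exists_le_of_coeff_ne_zero F
      refine ⟨B - m, fun n hn => ?_⟩
      have := hB _ (left_ne_zero_of_mul hn)
      simp only at this
      omega)

theorem diffSeries_coeff (F : ℂ⸨X⸩) (e : ℤ × ℤ) :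
    (diffSeries F).coeff (toLex e) = substSum (-1) 1 F (e.2, e.1) := rfl

/-- Multiplicativity of `F ↦ F(-x₂ + x₁)`, which is the Chu-Vandermonde identity. -/
theorem diffSeries_mul (F G : ℂ⸨X⸩) : diffSeries (F * G) = diffSeries F * diffSeries G := by
  ext e
  obtain ⟨⟨b, c⟩, rfl⟩ := toLex.surjective e
  rw [← mul_coeff_coeff, mul, diffSeries_coeff, substSum_eq]
  by_cases hb : 0 ≤ b
  swap
  · rw [if_neg hb, finsum_eq_zero_of_forall_eq_zero]
    intro x
    obtain ⟨⟨b', c'⟩, rfl⟩ := toLex.surjective x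
    by_cases hb' : 0 ≤ b'
    · rw [← toLex_sub, diffSeries_coeff (e := (b, c) - (b', c')), substSum_eq, if_neg, smul_zero]
      simp only [Prod.mk_sub_mk]
      omega
    · rw [diffSeries_coeff, substSum_eq, if_neg hb', zero_smul]
  lift b to ℕ using hb
  rw [if_pos (by positivity), Int.toNat_natCast, ← mul_coeff_coeff, mul]
  set S := (finite_support_mul F G (c + b)).toFinset with hS
  -- Sum over the exponents `n` of `F` and the pairs `j` of exponents of `x₁` in the two factors.
  rw [finsum_eq_sum_of_support_subset (s := S) _ (by rw [hS]; simp),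
    finsum_eq_sum_of_support_subset (s := (S ×ˢ Finset.HasAntidiagonal.antidiagonal b).image
      fun x : ℤ × ℕ × ℕ => toLex ((x.2.1 : ℤ), x.1 - (x.2.1 : ℤ))), Finset.sum_image, Finset.sum_product,
      Finset.sum_mul, Finset.sum_mul]
  · refine Finset.sum_congr rfl fun n _ => ?_
    have hV := Ring.add_choose_eq b (Commute.all n (c + b - n))
    rw [add_sub_cancel] at hV
    rw [hV]
    push_cast
    rw [Finset.mul_sum, Finset.sum_mul]
    refine Finset.sum_congr rfl fun j hj => ?_
    have hj' := Finset.HasAntidiagonal.mem_antidiagonal.mp hj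
    rw [← toLex_sub, diffSeries_coeff, diffSeries_coeff, substSum_eq, substSum_eq]
    have h1 : (b : ℤ) - j.1 = j.2 := by omega
    simp only [Prod.mk_sub_mk, h1]
    rw [if_pos (by positivity), if_pos (by positivity)]
    have h2 : (-1 : ℂ) ^ c = (-1) ^ (n - (j.1 : ℤ)) * (-1) ^ (c - (n - (j.1 : ℤ))) := by
      rw [← zpow_add₀ (by norm_num)]
      congr 1
      ring
    rw [h2, show n - j.1 + (j.1 : ℤ) = n by ring,
      show c - (n - (j.1 : ℤ)) + (j.2 : ℤ) = c + b - n by omega]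
    simp only [Int.toNat_natCast, smul_eq_mul]
    ring
  · rintro ⟨n, j⟩ hx ⟨n', j'⟩ hx' h
    have h1 := (Finset.HasAntidiagonal.mem_antidiagonal.mp (Finset.mem_product.mp hx).2)
    have h2 := (Finset.HasAntidiagonal.mem_antidiagonal.mp (Finset.mem_product.mp hx').2)
    have h3 := Prod.ext_iff.mp (toLex.injective h)
    simp only at h1 h2 h3
    ext <;> simp only <;> omega
  · intro x hx
    obtain ⟨⟨b', c'⟩, rfl⟩ := toLex.surjective x
    rw [Function.mem_support, ← toLex_sub, diffSeries_coeff, diffSeries_coeff, substSum_eq,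
      substSum_eq, Prod.mk_sub_mk] at hx
    simp only at hx
    have hb' : 0 ≤ b' := by
      by_contra h
      rw [if_neg h, zero_smul] at hx
      exact hx rfl
    have hb'' : 0 ≤ (b : ℤ) - b' := by
      by_contra h
      rw [if_neg h, smul_zero] at hx
      exact hx rfl
    rw [if_pos hb', if_pos hb''] at hx
    have hF := left_ne_zero_of_mul (left_ne_zero_of_mul (left_ne_zero_of_smul hx))
    have hG := left_ne_zero_of_mul (left_ne_zero_of_mul (right_ne_zero_of_smul hx))
    lift b' to ℕ using hb'
    rw [Finset.mem_coe, Finset.mem_image]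
    refine ⟨(c' + b', (b', b - b')), Finset.mem_product.mpr ⟨?_, ?_⟩, ?_⟩
    · rw [hS, Set.Finite.mem_toFinset, Function.mem_support]
      refine smul_ne_zero hF ?_
      rwa [show (c : ℤ) + b - (c' + b') = c - c' + (b - b') by ring]
    · rw [Finset.HasAntidiagonal.mem_antidiagonal]
      simp only
      omega
    · simp

theorem diffSeries_add (F G : ℂ⸨X⸩) : diffSeries (F + G) = diffSeries F + diffSeries G := by
  ext e
  obtain ⟨e, rfl⟩ := toLex.surjective e
  rw [HahnSeries.coeff_add, diffSeries_coeff, diffSeries_coeff, diffSeries_coeff, substSum,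
    substSum, substSum, HahnSeries.coeff_add, add_mul]

theorem diffSeries_zero : diffSeries 0 = 0 := by
  ext e
  obtain ⟨e, rfl⟩ := toLex.surjective e
  rw [diffSeries_coeff, substSum, HahnSeries.coeff_zero, zero_mul, HahnSeries.coeff_zero]

theorem diffSeries_sum {ι : Type*} (s : Finset ι) (F : ι → ℂ⸨X⸩) :
    diffSeries (∑ i ∈ s, F i) = ∑ i ∈ s, diffSeries (F i) :=
  map_sum (⟨⟨diffSeries, diffSeries_zero⟩, diffSeries_add⟩ : ℂ⸨X⸩ →+ HahnSeries (ℤ ×ₗ ℤ) ℂ) F s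

theorem diffPow_eq (k : ℕ) (e : ℤ × ℤ) :
    diffPow k e = (diffSeries (HahnSeries.single (k : ℤ) 1)).coeff (toLex e) := by
  obtain ⟨p, q⟩ := e
  rw [diffSeries_coeff, substSum_eq, diffPow, binomPow]
  simp only
  by_cases h : p + q = k
  · rw [add_comm q p, h, HahnSeries.coeff_single_same]
    simp only [and_true, Ring.choose_natCast]
    by_cases hq : 0 ≤ q <;> by_cases hp : 0 ≤ p
    · lift p to ℕ using hp
      lift q to ℕ using hq
      have : k = p + q := by omega
      subst this
      simp [(Nat.choose_symm_add : (p + q).choose p = _)]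
    · have : k.choose q.toNat = 0 := Nat.choose_eq_zero_of_lt (by omega)
      simp [hp, this]
    · have : k.choose p.toNat = 0 := Nat.choose_eq_zero_of_lt (by omega)
      simp [hq, this]
    · simp [hq, hp]
  · rw [if_neg (by simp [h]), add_comm q p, HahnSeries.coeff_single_of_ne h]
    simp

/-- `F(x₁)` as an element of `ℂ((x₂))((x₁))`. -/
def firstSeries (F : ℂ⸨X⸩) : HahnSeries (ℤ ×ₗ ℤ) ℂ :=
  lexSeries (fun e => if e.2 = 0 then F.coeff e.1 else 0)
    (by
      obtain ⟨B, hB⟩ := exists_le_of_coeff_ne_zero F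
      refine ⟨B, fun e he => hB _ ?_⟩
      split_ifs at he with h
      · exact he
      · exact absurd rfl he)
    (fun m => ⟨0, fun n hn => by
      by_contra h
      exact hn (if_neg (by omega))⟩)

theorem firstSeries_coeff_zero (F : ℂ⸨X⸩) (k : ℤ) :
    (firstSeries F).coeff (toLex (k, 0)) = F.coeff k := by
  simp [firstSeries, lexSeries]

theorem firstSeries_coeff_of_ne (F : ℂ⸨X⸩) (k : ℤ) {c : ℤ} (hc : c ≠ 0) :
    (firstSeries F).coeff (toLex (k, c)) = 0 := by
  simp [firstSeries, lexSeries, hc]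

theorem mul_firstSeries_coeff (P : HahnSeries (ℤ ×ₗ ℤ) ℂ) (F : ℂ⸨X⸩) (m n : ℤ) :
    (P * firstSeries F).coeff (toLex (m, n))
      = ∑ᶠ k : ℤ, F.coeff k * P.coeff (toLex (m - k, n)) := by
  rw [mul_comm, ← mul_coeff_coeff, mul, finsum_eq_finsum_comp (g := fun k : ℤ => toLex (k, (0 : ℤ)))]
  · refine finsum_congr fun k => ?_
    rw [← toLex_sub, smul_eq_mul, Prod.mk_sub_mk, sub_zero,
      firstSeries_coeff_zero]
  · intro a b h
    exact congrArg Prod.fst (toLex.injective h)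
  · intro x hx
    obtain ⟨⟨b, c⟩, rfl⟩ := toLex.surjective x
    have : c = 0 := by
      by_contra h
      apply hx
      rw [firstSeries_coeff_of_ne F b h, zero_smul]
    exact ⟨b, by rw [this]⟩

theorem diffPow_support_finite (k : ℕ) : (Function.support (diffPow k)).Finite := by
  refine (Finset.Icc (0 : ℤ) k ×ˢ Finset.Icc (0 : ℤ) k).finite_toSet.subset fun e he => ?_
  obtain ⟨p, q⟩ := e
  have h1 := Function.mem_support.mp he
  have h2 := h1
  rw [diffPow_eq, diffSeries_coeff, substSum_eq] at h2
  have hp : 0 ≤ p := by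
    by_contra h0
    exact h2 (if_neg h0)
  have hq : 0 ≤ q ∧ p + q = k := by
    by_contra h0
    exact h1 (if_neg h0)
  rw [Finset.mem_coe, Finset.mem_product, Finset.mem_Icc, Finset.mem_Icc]
  simp only
  omega

/-- The identity between binomial coefficients by which the substitutions `x₁ ↦ x₁ + x₂` and
`x₁ ↦ x₁ - x₂` are inverse to each other. -/
theorem sum_choose_mul_choose (m : ℤ) (s : ℕ) :
    ∑ j ∈ Finset.range (s + 1), (-1 : ℤ) ^ j * (Ring.choose (m + j) j *
      Ring.choose (m + s) (s - j)) = if s = 0 then 1 else 0 := by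
  have h (j : ℕ) (hj : j ∈ Finset.range (s + 1)) : (-1 : ℤ) ^ j * (Ring.choose (m + j) j *
      Ring.choose (m + s) (s - j)) = Ring.choose (m + s) s * ((-1) ^ j * s.choose j) := by
    have hj' : j ≤ s := Nat.lt_succ_iff.mp (Finset.mem_range.mp hj)
    have h1 := Ring.choose_smul_choose (m + s) (Nat.sub_le s j)
    rw [Nat.sub_sub_self hj', Nat.choose_symm hj', nsmul_eq_mul, Nat.cast_sub hj',
      show m + s - ((s : ℤ) - j) = m + j by ring] at h1
    linear_combination (-(-1 : ℤ) ^ j) * h1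
  rw [Finset.sum_congr rfl h, ← Finset.mul_sum, Int.alternating_sum_range_choose]
  split_ifs with h0
  · simp [h0]
  · simp

end FormalCalc

open FormalCalc

namespace WeakQuantumVertexAlgebra

variable {V : Type*} [AddCommGroup V] [Module ℂ V] (A : WeakQuantumVertexAlgebra V)

/-! ### Associativity and skew symmetry on the vacuum -/

theorem prod12_vac_eq_zero (u v : V) (m : ℤ) {n : ℤ} (hn : n < 0) :
    prod12 (A.Y u) (A.Y v) A.vac (m, n) = 0 := by
  rw [prod12, A.creation_neg v n hn, map_zero]

theorem prod21_vac_eq_zero (u v : V) {m : ℤ} (n : ℤ) (hm : m < 0) :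
    prod21 (A.Y v) (A.Y u) A.vac (m, n) = 0 := by
  rw [prod21, A.creation_neg u m hm, map_zero]

/-- `Y(u, x₀ + x₂) Y(v, x₂) 1 = Y(Y(u, x₀) v, x₂) 1`: the coefficient of `x₁⁻¹` in the `S`-Jacobi
identity applied to the vacuum. The term with reversed factors has no negative powers of `x₁`. -/
theorem assoc_vac (u v : V) (p : ℤ) (q : ℕ) :
    ∑ j ∈ Finset.range (q + 1), ((Ring.choose (p + j) j : ℤ) : ℂ) •
        HVertexOperator.coeff (A.Y u) (p + j)
          (HVertexOperator.coeff (A.Y v) ((q : ℤ) - j) A.vac)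
      = HVertexOperator.coeff (A.Y (HVertexOperator.coeff (A.Y u) p v)) q A.vac := by
  obtain ⟨r, u', v', f, hJ⟩ := A.sJacobi u v
  have h := congrFun (hJ A.vac) (p, -1, (q : ℤ))
  rw [Pi.sub_apply] at h
  -- Neither factor has negative powers of `x₁`.
  have h2 : mul delta2 (in12 (∑ i, mul (laurentDiff (f i))
      (prod21 (A.Y (v' i)) (A.Y (u' i)) A.vac))) (p, -1, (q : ℤ)) = 0 := by
    rw [mul, finsum_eq_zero_of_forall_eq_zero]
    rintro ⟨e₀, e₁, e₂⟩
    by_cases h1 : 0 ≤ e₁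
    · have : in12 (∑ i, mul (laurentDiff (f i)) (prod21 (A.Y (v' i)) (A.Y (u' i)) A.vac))
          ((p, -1, (q : ℤ)) - (e₀, e₁, e₂)) = 0 := by
        rw [in12]
        split_ifs
        · rw [Finset.sum_apply]
          refine Finset.sum_eq_zero fun i _ => ?_
          rw [mul, finsum_eq_zero_of_forall_eq_zero]
          rintro ⟨a, b⟩
          by_cases ha : 0 ≤ a
          · simp only [Prod.mk_sub_mk]
            rw [A.prod21_vac_eq_zero _ _ _ (by omega), smul_zero]
          · have : laurentDiff (f i) (a, b) = 0 := by
              simp [laurentDiff, substSum, binomPow, ha]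
            rw [this, zero_smul]
        · rfl
      rw [this, smul_zero]
    · have : delta2 (e₀, e₁, e₂) = 0 := by simp [delta2, binomPow, h1]
      rw [this, zero_smul]
  -- Only the monomial `x₁⁻¹` of `delta3` contributes, as `binom(n - 1, n) = 0` for `n > 0`.
  have h3 : mul delta3 (in02 (iterate A.Y A.Y u v A.vac)) (p, -1, (q : ℤ))
      = iterate A.Y A.Y u v A.vac (p, q) := by
    rw [mul, finsum_eq_single _ ((0 : ℤ), (-1 : ℤ), (0 : ℤ))]
    · simp [delta3, binomPow, in02]
    · rintro ⟨e₀, e₁, e₂⟩ hne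
      by_cases h1 : e₁ = -1
      swap
      · rw [in02, if_neg, smul_zero]
        simp only [Prod.mk_sub_mk]
        omega
      subst h1
      have : delta3 (e₀, -1, e₂) = 0 := by
        rw [delta3, binomPow]
        simp only
        split_ifs with h0
        · obtain ⟨n, rfl⟩ := Int.eq_ofNat_of_zero_le h0.1
          have hn : n ≠ 0 := by
            rintro rfl
            apply hne
            have : e₂ = 0 := by omega
            rw [this]; rfl
          obtain ⟨k, rfl⟩ := Nat.exists_eq_succ_of_ne_zero hn
          have h5 : -e₂ - 1 = (k : ℤ) := by push_cast at h0; omega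
          rw [h5, Ring.choose_natCast]
          simp
        · rfl
      rw [this, zero_smul]
  rw [h2, h3, sub_zero, mul] at h
  rw [iterate] at h
  rw [← h, finsum_eq_finsum_comp (g := fun j : ℕ => (p, -p - 1 - j, (j : ℤ))),
    finsum_eq_sum_of_support_subset (s := Finset.range (q + 1))]
  · refine Finset.sum_congr rfl fun j _ => ?_
    have hd : delta1 (p, -p - 1 - j, (j : ℤ)) = ((Ring.choose (p + j) j : ℤ) : ℂ) := by
      have hc := Ring.choose_neg (p + 1) j
      rw [show p + 1 + (j : ℤ) - 1 = p + j by ring] at hc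
      rw [delta1, binomPow, if_pos ⟨by simp, by simp⟩]
      simp only [Int.toNat_natCast, one_zpow, mul_one, zpow_natCast]
      rw [show -p - 1 = -(p + 1) by ring, hc, Units.smul_def, smul_eq_mul, Int.cast_mul,
        mul_right_comm]
      have : (((j : ℤ).negOnePow : ℤ) : ℂ) * (-1) ^ j = 1 := by
        rw [Int.negOnePow_def, zpow_natCast]
        push_cast
        rw [← mul_pow]
        simp
      rw [this, one_mul]
    rw [hd, in12, if_pos (by simp), prod12]
    simp only [Prod.mk_sub_mk]
    rw [show -1 - (-p - 1 - (j : ℤ)) = p + j by ring]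
  · intro j hj
    by_contra hjq
    apply Function.mem_support.mp hj
    rw [Finset.mem_coe, Finset.mem_range] at hjq
    rw [in12]
    split_ifs
    · simp only [Prod.mk_sub_mk]
      rw [A.prod12_vac_eq_zero _ _ _ (by omega), smul_zero]
    · rw [smul_zero]
  · intro a b hab
    simpa using hab
  · rintro ⟨e₀, e₁, e₂⟩ hne
    have h1 := left_ne_zero_of_smul hne
    have h2 := right_ne_zero_of_smul hne
    have h3 : p = e₀ := by
      by_contra h0
      apply h2
      rw [in12, if_neg]
      simp only [Prod.mk_sub_mk]
      omega
    have h4 : 0 ≤ e₂ ∧ e₁ + e₂ = -e₀ - 1 := by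
      by_contra h0
      exact h1 (if_neg h0)
    refine ⟨e₂.toNat, ?_⟩
    have h5 := Int.toNat_of_nonneg h4.1
    refine Prod.ext h3 (Prod.ext ?_ ?_)
    · simp only
      omega
    · exact h5


/-- `ψ(Y(a, x) 1) = e^(N x) ψ(a)` for all `a`: in terms of the translation operator `D`,
`ψ ∘ D = N ψ`. -/
def IsExponential (N : ℤ) (ψ : V →ₗ[ℂ] ℂ) : Prop :=
  ∀ (a : V) (q : ℕ), ψ (HVertexOperator.coeff (A.Y a) q A.vac)
    = (N : ℂ) ^ q / (q.factorial : ℂ) * ψ a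

variable {A} in
/-- The coefficients of `ψ(Y(v, y) Y(a, x) 1) = e^(N x) ψ(Y(v, y - x) a)`, obtained by inverting
`assoc_vac`. -/
theorem IsExponential.map_prod_vac {N : ℤ} {ψ : V →ₗ[ℂ] ℂ} (hψ : A.IsExponential N ψ)
    (a v : V) (m : ℤ) (n : ℕ) :
    ψ (HVertexOperator.coeff (A.Y v) m (HVertexOperator.coeff (A.Y a) n A.vac))
      = ∑ j ∈ Finset.range (n + 1), (N : ℂ) ^ (n - j) / ((n - j).factorial : ℂ) *
        (ψ (HVertexOperator.coeff (A.Y v) (m + j) a) * ((Ring.choose (m + j) j : ℤ) : ℂ)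
          * (-1) ^ j) := by
  set P : ℤ → ℤ → ℂ := fun m n =>
    ψ (HVertexOperator.coeff (A.Y v) m (HVertexOperator.coeff (A.Y a) n A.vac)) with hP
  -- Expand each `ψ(Y(v, y) a)` on the right by associativity, and sum over `s = i + j` first.
  set g : ℕ → ℕ → ℂ := fun j i => (-1) ^ j * ((Ring.choose (m + j) j : ℤ) : ℂ) *
    (((Ring.choose (m + j + i) i : ℤ) : ℂ) * P (m + j + i) (n - j - i)) with hg
  have h (j : ℕ) (hj : j ∈ Finset.range (n + 1)) : (N : ℂ) ^ (n - j) / ((n - j).factorial : ℂ) *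
        (ψ (HVertexOperator.coeff (A.Y v) (m + j) a) * ((Ring.choose (m + j) j : ℤ) : ℂ)
          * (-1) ^ j) = ∑ i ∈ Finset.range (n + 1 - j), g j i := by
    have hj' : j ≤ n := Nat.lt_succ_iff.mp (Finset.mem_range.mp hj)
    have h1 := congrArg ψ (A.assoc_vac v a (m + j) (n - j))
    rw [hψ, map_sum] at h1
    calc _ = (-1) ^ j * ((Ring.choose (m + j) j : ℤ) : ℂ) *
          ((N : ℂ) ^ (n - j) / ((n - j).factorial : ℂ) *
            ψ (HVertexOperator.coeff (A.Y v) (m + j) a)) := by ring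
      _ = _ := by
        rw [← h1, Finset.mul_sum, show n - j + 1 = n + 1 - j by omega]
        refine Finset.sum_congr rfl fun i _ => ?_
        rw [map_smul, smul_eq_mul, Nat.cast_sub hj']
  rw [Finset.sum_congr rfl h, ← Finset.sum_range_diag_flip]
  have h' (s : ℕ) (hs : s ∈ Finset.range (n + 1)) :
      ∑ j ∈ Finset.range (s + 1), g j (s - j) = if s = 0 then P m n else 0 := by
    have h2 : ∑ j ∈ Finset.range (s + 1), g j (s - j) =
        ((∑ j ∈ Finset.range (s + 1), (-1 : ℤ) ^ j * (Ring.choose (m + j) j *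
          Ring.choose (m + s) (s - j)) : ℤ) : ℂ) * P (m + s) (n - s) := by
      rw [Int.cast_sum, Finset.sum_mul]
      refine Finset.sum_congr rfl fun j hj => ?_
      have hj' : j ≤ s := Nat.lt_succ_iff.mp (Finset.mem_range.mp hj)
      simp only [hg]
      rw [Nat.cast_sub hj', show m + j + ((s : ℤ) - j) = m + s by ring,
        show (n : ℤ) - j - (s - j) = n - s by ring]
      push_cast
      ring
    rw [h2, FormalCalc.sum_choose_mul_choose]
    split_ifs with h0
    · simp [h0]
    · simp
  rw [Finset.sum_congr rfl h', Finset.sum_ite_eq' (Finset.range (n + 1)) 0,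
    if_pos (by simp)]

theorem coeff_map_bdd (ψ : V →ₗ[ℂ] ℂ) (u v : V) :
    ∃ B : ℤ, ∀ n < B, ψ (HVertexOperator.coeff (A.Y u) n v) = 0 := by
  obtain ⟨B, hB⟩ := coeff_eq_zero_of_lt (A.Y u) v
  exact ⟨B, fun n hn => by rw [hB n hn, map_zero]⟩

/-- The series `ψ(Y(u, z) v)`. -/
def matrixCoeff (ψ : V →ₗ[ℂ] ℂ) (u v : V) : ℂ⸨X⸩ := ofCoeff _ (A.coeff_map_bdd ψ u v)

theorem matrixCoeff_coeff (ψ : V →ₗ[ℂ] ℂ) (u v : V) (n : ℤ) :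
    (A.matrixCoeff ψ u v).coeff n = ψ (HVertexOperator.coeff (A.Y u) n v) := rfl

variable {A}

/-- `ψ(Y(v, x₂) Y(a, x₁) 1) = e^(N x₁) κ(x₂ - x₁)` with `κ(y) = ψ(Y(v, y) a)`. -/
theorem IsExponential.map_prod21_vac {N : ℤ} {ψ : V →ₗ[ℂ] ℂ} (hψ : A.IsExponential N ψ)
    (a v : V) (e : ℤ × ℤ) :
    ψ (prod21 (A.Y v) (A.Y a) A.vac e) =
      (diffSeries (dilate (-1) (A.matrixCoeff ψ v a)) * firstSeries (lexp ^ N)).coeff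
        (toLex e) := by
  obtain ⟨n, m⟩ := e
  rw [mul_firstSeries_coeff]
  by_cases hn : 0 ≤ n
  swap
  · rw [A.prod21_vac_eq_zero _ _ _ (not_le.mp hn), map_zero, finsum_eq_zero_of_forall_eq_zero]
    intro k
    by_cases hk : 0 ≤ k
    · rw [diffSeries_coeff, substSum_eq, if_neg (by simp only; omega), mul_zero]
    · rw [lexp_zpow_coeff_neg _ (not_le.mp hk), zero_mul]
  lift n to ℕ using hn
  rw [prod21, hψ.map_prod_vac, finsum_eq_finsum_comp (g := fun j : ℕ => (n : ℤ) - j),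
    finsum_eq_sum_of_support_subset (s := Finset.range (n + 1))]
  · refine Finset.sum_congr rfl fun j hj => ?_
    have hj' : j ≤ n := Nat.lt_succ_iff.mp (Finset.mem_range.mp hj)
    rw [← Nat.cast_sub hj', lexp_zpow_coeff, diffSeries_coeff, substSum_eq, Nat.cast_sub hj']
    simp only [sub_sub_cancel]
    rw [if_pos (Int.natCast_nonneg j), dilate_coeff, matrixCoeff_coeff, zpow_add]
    have hm : ((-1 : ℂ) ^ m) * (-1) ^ m = 1 := by
      rw [← mul_zpow]
      simp
    simp only [Units.val_mul, Units.val_zpow_eq_zpow_val, Units.val_pow_eq_pow_val,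
      Units.val_neg, Units.val_one, Int.toNat_natCast, zpow_natCast]
    linear_combination (-((N : ℂ) ^ (n - j) / ((n - j).factorial : ℂ)) *
      (ψ (HVertexOperator.coeff (A.Y v) (m + j) a) * ((Ring.choose (m + j) j : ℤ) : ℂ)
        * (-1) ^ j)) * hm
  · intro j hj
    by_contra hjn
    rw [Finset.mem_coe, Finset.mem_range] at hjn
    exact Function.mem_support.mp hj (by
      rw [lexp_zpow_coeff_neg _ (by omega), zero_mul])
  · intro i j hij
    simpa using hij
  · intro k hk
    have h2 := right_ne_zero_of_mul hk
    rw [diffSeries_coeff, substSum_eq] at h2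
    have h3 : 0 ≤ (n : ℤ) - k := by
      by_contra h0
      exact h2 (if_neg h0)
    exact ⟨((n : ℤ) - k).toNat, by simp only; omega⟩

theorem prod21_vac_finite (u v : V) (F : HahnSeries (ℤ ×ₗ ℤ) ℂ) (e : ℤ × ℤ) :
    (Function.support fun x : ℤ × ℤ => F.coeff (toLex x) •
      prod21 (A.Y v) (A.Y u) A.vac (e - x)).Finite :=
  finite_support_mul F (lexSeries (prod21 (A.Y v) (A.Y u) A.vac)
    ⟨0, fun e he => by
      by_contra h
      exact he (A.prod21_vac_eq_zero u v e.2 (not_le.mp h))⟩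
    (fun m => by
      obtain ⟨B, hB⟩ := coeff_eq_zero_of_lt (A.Y v) (HVertexOperator.coeff (A.Y u) m A.vac)
      refine ⟨B, fun n hn => ?_⟩
      by_contra h
      exact hn (hB n (not_le.mp h)))) (toLex e)

/-- **Skew symmetry**: `ψ(Y(u, z) v) = ∑ fᵢ(e^z) e^(N z) ψ(Y(v⁽ⁱ⁾, -z) u⁽ⁱ⁾)`. Apply `ψ` to the
locality relation on the vacuum: the right side becomes `g(-x₂ + x₁) e^(N x₁)`, where
`g(z) = z^k ∑ fᵢ(e^z) ψ(Y(v⁽ⁱ⁾, -z) u⁽ⁱ⁾)`, and the left side has no negative powers of `x₂`. The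
coefficients at `x₁⁰` show that `g` is a power series, those at `x₂⁰` give the claim. -/
theorem IsExponential.skew {N : ℤ} {ψ : V →ₗ[ℂ] ℂ} (hψ : A.IsExponential N ψ)
    {u v : V} {r : ℕ} {u' v' : Fin r → V} {f : Fin r → RatFunc ℂ} {k : ℕ}
    (hloc : A.TrigSLocal u v u' v' f k) :
    A.matrixCoeff ψ u v =
      (∑ i, ratExp (f i) * dilate (-1) (A.matrixCoeff ψ (v' i) (u' i))) * lexp ^ N := by
  set g := HahnSeries.single (k : ℤ) (1 : ℂ) *
    ∑ i, ratExp (f i) * dilate (-1) (A.matrixCoeff ψ (v' i) (u' i)) with hg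
  have key (e : ℤ × ℤ) :
      mul (diffPow k) (fun e => ψ (prod12 (A.Y u) (A.Y v) A.vac e)) e =
        (diffSeries g * firstSeries (lexp ^ N)).coeff (toLex e) := by
    have hfin (B : ℤ × ℤ → V) (e : ℤ × ℤ) :
        (Function.support fun x => diffPow k x • B (e - x)).Finite :=
      (diffPow_support_finite k).subset fun x hx => left_ne_zero_of_smul hx
    rw [← map_mul_apply ψ (hfin _ _), hloc A.vac, map_mul_apply ψ (hfin _ _), hg,
      diffSeries_mul, diffSeries_sum, mul_assoc, Finset.sum_mul]
    refine mul_coeff_toLex (diffPow_eq k) (fun e => ?_) e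
    rw [Finset.sum_apply, map_sum, HahnSeries.coeff_sum]
    refine Finset.sum_congr rfl fun i _ => ?_
    have h1 (x : ℤ × ℤ) : ratExpDiff (f i) x = (diffSeries (ratExp (f i))).coeff (toLex x) := rfl
    have h2 : (Function.support fun x => ratExpDiff (f i) x •
        prod21 (A.Y (v' i)) (A.Y (u' i)) A.vac (e - x)).Finite :=
      prod21_vac_finite (u' i) (v' i) (diffSeries (ratExp (f i))) e
    rw [diffSeries_mul, mul_assoc, map_mul_apply ψ h2]
    exact mul_coeff_toLex h1 (fun e => hψ.map_prod21_vac _ _ e) e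
  -- The coefficient of `x₁⁰ x₂ⁿ` is `(-1)ⁿ gₙ` on the right, and `0` on the left for `n < 0`.
  have hg0 (n : ℤ) (hn : n < 0) : g.coeff n = 0 := by
    have h := key (0, n)
    rw [mul, finsum_eq_zero_of_forall_eq_zero, mul_firstSeries_coeff, finsum_eq_single _ 0] at h
    · have h0 : (lexp ^ N).coeff 0 = 1 := by simpa using lexp_zpow_coeff N 0
      rw [diffSeries_coeff, substSum_eq, h0, one_mul, sub_zero, if_pos le_rfl] at h
      have h1 : (-1 : ℂ) ^ n ≠ 0 := zpow_ne_zero _ (by norm_num)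
      simpa [h1] using h.symm
    · intro j hj
      by_cases h0 : 0 ≤ j
      · rw [diffSeries_coeff, substSum_eq, if_neg (by simp only; omega), mul_zero]
      · rw [lexp_zpow_coeff_neg _ (not_le.mp h0), zero_mul]
    · rintro ⟨p, q⟩
      by_cases hq : 0 ≤ q
      · rw [Prod.mk_sub_mk, A.prod12_vac_eq_zero _ _ _ (by omega), map_zero, smul_zero]
      · rw [diffPow, binomPow, if_neg (fun h => hq h.1), zero_smul]
  -- Compare the coefficients of `x₁ᵐ x₂⁰`. On the right, those of `g(-x₂ + x₁)` are the coefficients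
  -- of `g`, but only at nonnegative exponents, and `g` has no others.
  have hgη : HahnSeries.single (k : ℤ) 1 * A.matrixCoeff ψ u v = g * lexp ^ N := by
    ext m
    have h := key (m, 0)
    have h1 : (HahnSeries.single (k : ℤ) 1 * A.matrixCoeff ψ u v).coeff m
        = (A.matrixCoeff ψ u v).coeff (m - k) := by
      have := HahnSeries.coeff_single_mul_add (r := (1 : ℂ)) (x := A.matrixCoeff ψ u v)
        (a := m - k) (b := (k : ℤ))
      rwa [sub_add_cancel, one_mul] at this
    rw [mul_firstSeries_coeff, mul, finsum_eq_single _ ((k : ℤ), (0 : ℤ))] at h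
    · rw [h1, mul_comm g, ← mul_coeff_coeff, mul, matrixCoeff_coeff]
      simp only [Prod.mk_sub_mk, prod12, sub_zero, A.creation_zero] at h
      rw [show diffPow k ((k : ℤ), 0) = 1 by simp [diffPow, binomPow], one_smul] at h
      rw [h]
      refine finsum_congr fun j => ?_
      rw [diffSeries_coeff, substSum_eq, smul_eq_mul]
      congr 1
      simp only [zero_add]
      split_ifs with hj
      · obtain ⟨i, hi⟩ := Int.eq_ofNat_of_zero_le hj
        rw [hi, Int.toNat_natCast, Ring.choose_natCast, Nat.choose_self]
        simp
      · rw [hg0 _ (not_le.mp hj)]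
    · rintro ⟨p, q⟩ hne
      by_cases hq : 0 ≤ q ∧ p + q = k
      · have : q ≠ 0 := by
          rintro rfl
          apply hne
          rw [← hq.2, add_zero]
        rw [Prod.mk_sub_mk, A.prod12_vac_eq_zero _ _ _ (by omega), map_zero, smul_zero]
      · rw [diffPow, binomPow, if_neg hq, zero_smul]
  rw [hg, mul_assoc] at hgη
  exact mul_left_cancel₀ (by simp) hgη

end WeakQuantumVertexAlgebra

namespace WeakQuantumVertexAlgebra.PhiQuasiModule

variable {V W : Type*} [AddCommGroup V] [Module ℂ V] [AddCommGroup W] [Module ℂ W]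
  {A : WeakQuantumVertexAlgebra V} (M : A.PhiQuasiModule W)

/-! ### The commutator formula -/

/-- The linear functional `a ↦ φ(a_N w)`, where `a_N` is the coefficient of `x^N` in
`Y_W(a, x)`. -/
def modeFunctional (φ : W →ₗ[ℂ] ℂ) (w : W) (N : ℤ) : V →ₗ[ℂ] ℂ where
  toFun a := φ (HVertexOperator.coeff (M.Y a) N w)
  map_add' a b := by rw [map_add, map_add, Pi.add_apply, LinearMap.add_apply, map_add]
  map_smul' c a := by
    rw [map_smul, map_smul, Pi.smul_apply, LinearMap.smul_apply, map_smul, RingHom.id_apply]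

theorem modeFunctional_apply (φ : W →ₗ[ℂ] ℂ) (w : W) (N : ℤ) (a : V) :
    M.modeFunctional φ w N a = φ (HVertexOperator.coeff (M.Y a) N w) := rfl

/-- `Y_W(Y(a, z) 1, x) = Y_W(a, x e^z)`: the correlation function of `a` and `1` is a multiple of
`t^N`. -/
theorem isExponential_modeFunctional (φ : W →ₗ[ℂ] ℂ) (w : W) (N : ℤ) :
    A.IsExponential N (M.modeFunctional φ w N) := by
  intro a q
  obtain ⟨R, hR⟩ := M.exists_isCorrelation φ w N a A.vac
  have hR' : R = RatFunc.C (M.modeFunctional φ w N a) * RatFunc.X ^ N := by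
    apply expandInfty.injective
    ext k
    rw [map_mul, expandInfty_X_zpow, expandInfty, ratSubst_C, C_mul_coeff, ← expandInfty,
      ← neg_neg k, hR.coeff_infty, prod12, M.vac_coeff]
    by_cases h : -k = N
    · subst h
      simp only [sub_self, if_true, neg_neg, HahnSeries.coeff_single_same, mul_one]
      rfl
    · rw [if_neg (by simp only; omega), map_zero, map_zero,
        HahnSeries.coeff_single_of_ne (by omega), mul_zero]
  have h := hR.coeff_exp q
  rw [hR', map_mul, expandExp_X_zpow, expandExp, ratSubst_C, C_mul_coeff, C_mul_coeff,
    lexp_zpow_coeff] at h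
  rw [modeFunctional_apply]
  refine h.symm.trans ?_
  simp [mul_comm]

variable {M} {φ : W →ₗ[ℂ] ℂ} {w : W} {N : ℤ} {u v : V} {R : RatFunc ℂ}

theorem IsCorrelation.expandExp_eq (hR : M.IsCorrelation φ w N u v R) :
    expandExp 1 R = A.matrixCoeff (M.modeFunctional φ w N) u v := by
  ext n
  rw [hR.coeff_exp]
  rfl

theorem map_mul_ratRatio (f : RatFunc ℂ) {a b : V} {S : RatFunc ℂ}
    (hS : M.IsCorrelation φ w N b a S) (m : ℤ) :
    φ (mul (ratRatio f) (prod21 (M.Y b) (M.Y a) w) (m, N - m))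
      = (expandZero (f * ratInv S * RatFunc.X ^ N)).coeff m := by
  have h1 : ∃ B : ℤ, ∀ n < B, prod21 (M.Y b) (M.Y a) w (n, N - n) = 0 := by
    obtain ⟨B, hB⟩ := coeff_eq_zero_of_lt (M.Y a) w
    exact ⟨B, fun n hn => by rw [prod21, hB n hn, map_zero]⟩
  have h2 : ∃ B : ℤ, ∀ n < B, φ (prod21 (M.Y b) (M.Y a) w (n, N - n)) = 0 := by
    obtain ⟨B, hB⟩ := h1
    exact ⟨B, fun n hn => by rw [hB n hn, map_zero]⟩
  have h3 : ofCoeff (fun n => φ (prod21 (M.Y b) (M.Y a) w (n, N - n))) h2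
      = expandZero (ratInv S * RatFunc.X ^ N) := by
    ext n
    rw [map_mul, expandZero_X_zpow, mul_comm, single_mul_coeff, expandZero_ratInv,
      ← neg_sub N n, hS.coeff_infty, sub_sub_cancel]
    rfl
  rw [ratRatio, mul_substRatio, mul_assoc, map_mul, expandZero_apply f, ← h3,
    ← map_finsum_smul φ _ _ h1 h2]
  congr 1
  refine finsum_congr fun k => ?_
  rw [show N - m + k = N - (m - k) by ring]

/-- Skew symmetry of correlation functions: `R(t) = ∑ fᵢ(t) t^N Sᵢ(t⁻¹)`. Both sides agree after
`t = e^z` by the skew symmetry in `V`, and the expansion at `t = 1` is injective. -/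
theorem IsCorrelation.skew (hR : M.IsCorrelation φ w N u v R) {r : ℕ} {u' v' : Fin r → V}
    {f : Fin r → RatFunc ℂ} {k : ℕ} (hloc : A.TrigSLocal u v u' v' f k) {S : Fin r → RatFunc ℂ}
    (hS : ∀ i, M.IsCorrelation φ w N (v' i) (u' i) (S i)) :
    R = ∑ i, f i * ratInv (S i) * RatFunc.X ^ N := by
  apply (expandExp 1).injective
  rw [hR.expandExp_eq, (M.isExponential_modeFunctional φ w N).skew hloc, map_sum, Finset.sum_mul]
  refine Finset.sum_congr rfl fun i _ => ?_
  rw [← (hS i).expandExp_eq, map_mul, map_mul, expandExp_ratInv, ratExp_eq, expandExp_X_zpow,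
    Units.val_one, one_zpow, map_one HahnSeries.C, one_mul]

/-- The commutator is the difference of the expansions of the correlation function at `∞` and
at `0`. -/
theorem IsCorrelation.map_twistedCommutator (hR : M.IsCorrelation φ w N u v R) {r : ℕ}
    {u' v' : Fin r → V} {f : Fin r → RatFunc ℂ} {k : ℕ} (hloc : A.TrigSLocal u v u' v' f k)
    (m : ℤ) : φ (M.twistedCommutator u v u' v' f w (m, N - m))
      = (expandInfty R).coeff (-m) - (expandZero R).coeff m := by
  choose S hS using fun i => M.exists_isCorrelation φ w N (v' i) (u' i)
  rw [twistedCommutator, Pi.sub_apply, map_sub, hR.coeff_infty, Finset.sum_apply, map_sum]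
  conv_rhs => rw [hR.skew hloc hS, map_sum, HahnSeries.coeff_sum]
  congr 1
  exact Finset.sum_congr rfl fun i _ => map_mul_ratRatio (f i) (hS i) m

theorem deltaTerm_apply (a : V) (c : ℂˣ) (m n : ℤ) : M.deltaTerm a v (c : ℂ) w (m, n)
    = ∑ᶠ j : ℤ, (HahnSeries.C ((c : ℂ) ^ (-m)) * lexp ^ (-m)).coeff j •
      iterate A.Y M.Y a v w (-1 - j, m + n) := by
  rw [deltaTerm, res0, mul, finsum_eq_finsum_comp (g := fun j : ℤ => (j, m, -m))]
  · refine finsum_congr fun j => ?_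
    rw [in02, if_pos (by simp)]
    simp only [Prod.mk_sub_mk]
    rw [show n - -m = m + n by ring]
    congr 1
    by_cases hj : 0 ≤ j
    · lift j to ℕ using hj
      rw [expEuler_deltaScaled, if_pos (by ring)]
    · rw [expEuler, if_neg hj, C_mul_coeff, lexp_zpow_coeff_neg _ (not_le.mp hj), mul_zero]
  · intro i j hij
    exact congrArg Prod.fst hij
  · rintro ⟨e₀, e₁, e₂⟩ hne
    have h1 : e₁ = m := by
      by_contra h0
      apply right_ne_zero_of_smul hne
      rw [in02, if_neg]
      simp only [Prod.mk_sub_mk]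
      omega
    have h0 : 0 ≤ e₀ := by
      by_contra h0
      exact left_ne_zero_of_smul hne (if_neg h0)
    lift e₀ to ℕ using h0
    have h2 : e₁ + e₂ = 0 := by
      by_contra h0
      apply left_ne_zero_of_smul hne
      rw [expEuler_deltaScaled, if_neg h0]
    exact ⟨e₀, Prod.ext rfl (Prod.ext h1.symm (by simp only; omega))⟩

variable {G : Type*} [Group G] {ρ : G →* A.aut} {χ : G →* ℂˣ}

/-- Covariance: the correlation function of `g u` and `v` is `R(χ(g) t)`. -/
theorem IsCorrelation.ratScale (hM : M.IsCovariant ρ χ) (hR : M.IsCorrelation φ w N u v R)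
    (g : G) : M.IsCorrelation φ w N ((ρ g : V ≃ₗ[ℂ] V) u) v (ratScale (χ g) R) := by
  obtain ⟨S, hS⟩ := M.exists_isCorrelation φ w N ((ρ g : V ≃ₗ[ℂ] V) u) v
  suffices h : S = FormalCalc.ratScale (χ g) R by rwa [← h]
  apply expandInfty.injective
  ext k
  rw [expandInfty_ratScale, dilate_coeff, ← neg_neg k, hS.coeff_infty, hR.coeff_infty, prod12,
    hM.covariant, map_smul, smul_eq_mul, prod12]
  simp

theorem IsCorrelation.map_deltaTerm (hM : M.IsCovariant ρ χ) (hR : M.IsCorrelation φ w N u v R)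
    (g : G) (m : ℤ) :
    φ (M.deltaTerm ((ρ g : V ≃ₗ[ℂ] V) u) v (χ g : ℂ) w (m, N - m))
      = (expandExp (χ g) (RatFunc.X ^ (-m) * R)).coeff (-1) := by
  have hS := hR.ratScale hM g
  have h1 := M.iterate_bdd w N ((ρ g : V ≃ₗ[ℂ] V) u) v
  have h2 : ∃ B : ℤ, ∀ n < B, φ (iterate A.Y M.Y ((ρ g : V ≃ₗ[ℂ] V) u) v w (n, N)) = 0 := by
    obtain ⟨B, hB⟩ := h1
    exact ⟨B, fun n hn => by rw [hB n hn, map_zero]⟩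
  rw [deltaTerm_apply, add_sub_cancel, map_finsum_smul φ _ _ h1 h2, map_mul, expandExp_X_zpow]
  congr 2
  ext n
  rw [← expandExp_ratScale, hS.coeff_exp]
  rfl

/-- The residue theorem for `x₁^(-m) R`: the coefficient of `t^m` in the difference of the expansions
of the correlation function at `∞` and at `0`. -/
theorem IsCorrelation.residue (hR : M.IsCorrelation φ w N u v R) {p : Polynomial ℂ} (hp : p ≠ 0)
    (hL : IsLaurent (mul (polyRatio p) (prod12 (M.Y u) (M.Y v) w))) {Λ : Finset ℂˣ}
    (hΛ : ∀ z : ℂ, p.eval z = 0 → ∃ c ∈ Λ, (c : ℂ) = z) (m : ℤ) :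
    (expandInfty R).coeff (-m) - (expandZero R).coeff m
      = ∑ c ∈ Λ, (expandExp c (RatFunc.X ^ (-m) * R)).coeff (-1) := by
  obtain ⟨E, hE⟩ := hR.exists_mul_eq hL
  obtain ⟨s, q, hq⟩ := exists_laurentPoly_mul_X_pow E
  -- The power of `t` clears the negative exponents; the residue theorem allows a zero of `p` at `0`.
  rw [← expandInfty_sub_expandZero (p := p * Polynomial.X ^ (s + m.natAbs))
    (q := q * Polynomial.X ^ (m.natAbs - m).toNat)]
  · rw [map_mul, map_mul, expandInfty_X_zpow, expandZero_X_zpow, single_mul_coeff,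
      single_mul_coeff]
    simp
  · exact mul_ne_zero hp (pow_ne_zero _ Polynomial.X_ne_zero)
  · intro z hz
    rw [Polynomial.eval_mul, Polynomial.eval_pow, Polynomial.eval_X] at hz
    rcases mul_eq_zero.mp hz with h | h
    · exact Or.inr (hΛ z h)
    · exact Or.inl (eq_zero_of_pow_eq_zero h)
  · have hX : (RatFunc.X : RatFunc ℂ) ^ (-m) * RatFunc.X ^ m.natAbs
        = RatFunc.X ^ (m.natAbs - m).toNat := by
      rw [← zpow_natCast, ← zpow_natCast, ← zpow_add₀ RatFunc.X_ne_zero,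
        Int.toNat_of_nonneg (by omega)]
      congr 1
      ring
    simp only [map_mul, map_pow, RatFunc.algebraMap_X]
    rw [← hX, ← hq, ← hE]
    ring

/-- Series in `(x₁, x)` may be compared by linear functionals, one total degree at a time. -/
theorem ext_dual {a b : W → ℤ × ℤ → W}
    (h : ∀ (φ : W →ₗ[ℂ] ℂ) (w : W) (N m : ℤ), φ (a w (m, N - m)) = φ (b w (m, N - m))) :
    a = b := by
  funext w ⟨m, n⟩
  rw [← sub_eq_zero, ← Module.forall_dual_apply_eq_zero_iff ℂ]
  intro φ
  have := h φ w (m + n) m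
  rw [add_sub_cancel_left] at this
  rw [map_sub, this, sub_self]

/-- The commutator formula, for any finite set `Λ` that contains the zeros of a polynomial as in
quasi-compatibility, and any section `s` of the character over `Λ`. -/
theorem twistedCommutator_eq_sum (hM : M.IsCovariant ρ χ) {r : ℕ} {u' v' : Fin r → V}
    {f : Fin r → RatFunc ℂ} {k : ℕ} (hloc : A.TrigSLocal u v u' v' f k)
    {p : Polynomial ℂ} (hp : p ≠ 0)
    (hL : ∀ w, IsLaurent (mul (polyRatio p) (prod12 (M.Y u) (M.Y v) w))) {Λ : Finset ℂˣ}
    (hΛ : ∀ z : ℂ, p.eval z = 0 → ∃ c ∈ Λ, (c : ℂ) = z) {s : ℂˣ → G} (hs : ∀ c ∈ Λ, χ (s c) = c) :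
    M.twistedCommutator u v u' v' f
      = ∑ c ∈ Λ, M.deltaTerm ((ρ (s c) : V ≃ₗ[ℂ] V) u) v (χ (s c) : ℂ) := by
  refine ext_dual fun φ w N m => ?_
  obtain ⟨R, hR⟩ := M.exists_isCorrelation φ w N u v
  rw [hR.map_twistedCommutator hloc, hR.residue hp (hL w) hΛ, Finset.sum_apply, Finset.sum_apply,
    map_sum]
  refine Finset.sum_congr rfl fun c hc => ?_
  rw [hR.map_deltaTerm hM, hs c hc]

/-- The delta term at a point that is not a pole vanishes. By the residue theorem, for `Λ` and for
`Λ` with this point added, it contributes nothing. -/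
theorem deltaTerm_eq_zero (hM : M.IsCovariant ρ χ) {p : Polynomial ℂ} (hp : p ≠ 0)
    (hL : ∀ w, IsLaurent (mul (polyRatio p) (prod12 (M.Y u) (M.Y v) w))) {Λ : Finset ℂˣ}
    (hΛ : ∀ z : ℂ, p.eval z = 0 → ∃ c ∈ Λ, (c : ℂ) = z) {g : G} (hg : χ g ∉ Λ) :
    M.deltaTerm ((ρ g : V ≃ₗ[ℂ] V) u) v (χ g : ℂ) = 0 := by
  classical
  refine ext_dual fun φ w N m => ?_
  obtain ⟨R, hR⟩ := M.exists_isCorrelation φ w N u v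
  have h1 := hR.residue hp (hL w) hΛ m
  have h2 := hR.residue hp (hL w) (Λ := insert (χ g) Λ)
    (fun z hz => (hΛ z hz).imp fun c hc => ⟨Finset.mem_insert_of_mem hc.1, hc.2⟩) m
  rw [h1, Finset.sum_insert hg, right_eq_add] at h2
  rw [hR.map_deltaTerm hM, h2]
  exact (map_zero φ).symm

end WeakQuantumVertexAlgebra.PhiQuasiModule

end

theorem theorem4p18 {V W G : Type*} [AddCommGroup V] [Module ℂ V] [AddCommGroup W] [Module ℂ W]
    [Group G] (A : WeakQuantumVertexAlgebra V) (hT : A.IsTType)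
    (ρ : G →* A.aut) (χ : G →* ℂˣ)
    (M : A.PhiQuasiModule W) (hM : M.IsCovariant ρ χ)
    (u v : V) {r : ℕ} (u' v' : Fin r → V) (f : Fin r → RatFunc ℂ)
    (hloc : ∃ k : ℕ, A.TrigSLocal u v u' v' f k) :
    (∃ (n : ℕ) (g : Fin n → G), Function.Injective (fun j => χ (g j)) ∧
      M.twistedCommutator u v u' v' f
        = ∑ j, M.deltaTerm ((ρ (g j) : V ≃ₗ[ℂ] V) u) v (χ (g j) : ℂ)) ∧
    (Function.Injective χ →
      {g : G | M.deltaTerm ((ρ g : V ≃ₗ[ℂ] V) u) v (χ g : ℂ) ≠ 0}.Finite ∧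
      M.twistedCommutator u v u' v' f
        = ∑ᶠ g : G, M.deltaTerm ((ρ g : V ≃ₗ[ℂ] V) u) v (χ g : ℂ)) := by
  classical
  obtain ⟨k, hloc⟩ := hloc
  obtain ⟨p, hp, hroots, hL⟩ := hM.quasi_compatible u v
  set Λ : Finset ℂˣ := p.roots.toFinset.preimage Units.val Units.val_injective.injOn with hΛdef
  have hmem (c : ℂˣ) : c ∈ Λ ↔ p.eval (c : ℂ) = 0 := by
    rw [hΛdef, Finset.mem_preimage, Multiset.mem_toFinset, Polynomial.mem_roots hp,
      Polynomial.IsRoot.def]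
  have hΛ (z : ℂ) (hz : p.eval z = 0) : ∃ c ∈ Λ, (c : ℂ) = z := by
    obtain ⟨g, rfl⟩ := hroots z hz
    exact ⟨χ g, (hmem _).mpr hz, rfl⟩
  have hsec (c : ℂˣ) : ∃ g : G, c ∈ Λ → χ g = c := by
    by_cases hc : c ∈ Λ
    · obtain ⟨g, hg⟩ := hroots c ((hmem c).mp hc)
      exact ⟨g, fun _ => Units.ext hg⟩
    · exact ⟨1, fun h => absurd h hc⟩
  choose s hs using hsec
  have key := M.twistedCommutator_eq_sum hM hloc hp hL hΛ hs
  refine ⟨⟨Λ.card, fun j => s (Λ.equivFin.symm j), ?_, ?_⟩, fun hχ => ?_⟩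
  · intro i j hij
    simp only [hs _ (Λ.equivFin.symm _).2] at hij
    exact Λ.equivFin.symm.injective (Subtype.ext hij)
  · rw [key, ← Finset.sum_coe_sort, ← Λ.equivFin.symm.sum_comp]
  · have hsupp : {g : G | M.deltaTerm ((ρ g : V ≃ₗ[ℂ] V) u) v (χ g : ℂ) ≠ 0} ⊆ Λ.image s := by
      intro g hg
      have hgΛ : χ g ∈ Λ := by
        by_contra h
        exact hg (M.deltaTerm_eq_zero hM hp hL hΛ h)
      exact Finset.mem_image.mpr ⟨χ g, hgΛ, hχ (hs _ hgΛ)⟩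
    refine ⟨(Finset.finite_toSet _).subset hsupp, ?_⟩
    rw [finsum_eq_sum_of_support_subset _ hsupp, Finset.sum_image, key]
    intro c hc d hd hcd
    rw [← hs c hc, hcd, hs d hd]
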